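/- **Games.** Let $n\ge 2$, $\mathcal Q=\{1,\dots,\bar q\}$ with $\bar q\ge 1$, and for each $q\in\mathcal Q$ let $\phi_q^i:\mathbb R^n\to\mathbb R$, $i=1,\dots,n$, be continuously differentiable costs with pseudo-gradient $\mathcal G_q=(\partial\phi_q^1/\partial x^1,\dots,\partial\phi_q^n/\partial x^n)$. Assume that each $\mathcal G_q$ is $\kappa_q$-strongly monotone and $\ell_q$-globally Lipschitz ($\kappa_q,\ell_q>0$), and that all games share a Nash equilibrium $\tilde x\in\mathbb R^n$, i.e. $\phi^i_q(\tilde x)=\inf_{y\in\mathbb R}\phi^i_q(y,\tilde x^{-i})$ for all $i,q$. Assume that each $\mathcal G_q$ is differentiable and that, for some $\sigma_q>0$, the maximum singular value of $I-\partial\mathcal G_q(x)$ is at most $\sigma_q$ for all $x\in\mathbb R^n$. **Parameters.** Let $T>0$, $k\ge 1$, $N_0\ge 1$, $\tau_d>0$, $\overline\eta>\underline\eta>0$ and $\eta(\tau)=\tau(\overline\eta-\underline\eta)/N_0+\underline\eta$. Put $\underline\kappa=\min_q\kappa_q$, $\overline\ell=\max_q\ell_q$, $\overline\sigma=\max_q\sigma_q$,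 $\zeta_q=\kappa_q/\ell_q^2$, $\underline\zeta=\min_q\zeta_q$. Assume that $\delta_\eta\in(0,1)$ and $\delta_d>0$ satisfy $\delta_\eta+\delta_d\in(0,1)$ and $$\overline\eta^2\le\delta_\eta\frac{\underline\zeta}{\overline\sigma^2},\qquad \frac1{\tau_d}\le\delta_d\frac{N_0}{\overline\eta-\underline\eta}\,\underline\zeta,\qquad \overline\gamma:=\frac{\overline\ell^2}{\underline\kappa^2}\frac{\eta(N_0-1)^2}{\eta(1)^2}+\frac1{2\underline\kappa^2\eta(1)^2}\in(0,1].$$ **Dynamics.** Consider the hybrid system with state $z=(x_1,x_2,\tau,q,\mu)\in\mathbb R^n\times\mathbb R^n\times\mathbb R\times\mathbb R\times\mathbb R$ that flows on $\mathbb R^{2n}\times[0,N_0]\times\mathcal Q\times\mathbb R_{\ge1}$ according to $$\dot x_1=\mu\tfrac{2}{\eta(\tau)}(x_2-x_1),\quad \dot x_2=-2\mu\,\eta(\tau)\mathcal G_q(x_1),\quad \dot\tau\in\left[0,\tfrac{\mu}{\tau_d}\right],\quad \dot q=0,\quad \dot\mu=\tfrac kT\mu^{1+1/k},$$ and jumps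 on $\mathbb R^{2n}\times[1,N_0]\times\mathcal Q\times\mathbb R_{\ge1}$ according to $$x_1^+=x_1,\quad x_2^+=x_1,\quad \tau^+=\tau-1,\quad q^+\in\mathcal Q\setminus\{q\},\quad \mu^+=\mu.$$ Its solutions are hybrid arcs on hybrid time domains, locally absolutely continuous during flows. **Claim.** Suppose that $$\tau_d>\frac{\max\{3,\,2(\underline\kappa^{-2}+\overline\eta^2)\}}{4\underline\eta\,\nu}\,\ln\!\left(\frac{\max\{3,\,2+2\overline\ell^2\overline\eta^2\}}{\min\{1,\,2\underline\eta\,\underline\kappa^2\}}\right),\qquad \nu=\frac{(1-\delta_d-\delta_\eta)\overline\sigma^2}{\delta_\eta(1-\delta_d)\underline\zeta+\overline\sigma^2}.$$ Then the set $\mathcal A=\{\tilde x\}\times\{\tilde x\}\times[0,N_0]\times\mathcal Q\times\mathbb R_{\ge1}$ is prescribed-time stable via flows (PT-S$_{\mathrm F}$): there is a function $\beta$ of class $\mathcal{KLL}$ such that every solution $z$, with $\mu_0\ge 1$ the $\mu$-component of $z(0,0)$, satisfies $$|z(t,j)|_{\mathcal A}\le\beta\big(|z(0,0)|_{\mathcal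 A},\,\mathcal T_k(t),\,j\big)\qquad\text{for all }(t,j)\in\operatorname{dom}(z).$$ Here $|\cdot|_{\mathcal A}$ is the Euclidean distance to $\mathcal A$. With $\Upsilon=T\mu_0^{-1/k}$ and $\mu_k(t)=T^k/(\Upsilon-t)^k$ for $t\in[0,\Upsilon)$, the dilated time is $\mathcal T_k(t)=\frac Tk\cdot\frac{\mu_k(t)^{\rho}-\mu_0^{\rho}}{\rho}$ with $\rho=\frac{k-1}{k}$ if $k>1$, and $\mathcal T_1(t)=T\ln(\mu_1(t)/\mu_0)$ if $k=1$. A function $\beta:\mathbb R_{\ge0}^3\to\mathbb R_{\ge0}$ is of class $\mathcal{KLL}$ if, for each fixed value of its second argument and for each fixed value of its third argument, the resulting function of the other two arguments is nondecreasing in the first and nonincreasing in the other one, tends to $0$ as the first tends to $0^+$, and tends to $0$ as the other one tends to $\infty$. -/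

import Mathlib

open Set Filter Topology MeasureTheory

noncomputable section

namespace PTNash

/-! ### Hybrid time domains, hybrid arcs and solutions of hybrid systems -/

/-- The product of two spaces with the Euclidean (`ℓ²`) norm. -/
abbrev L2Prod (α β : Type*) := WithLp 2 (α × β)

/-- Data `(C, F, D, G)` of a hybrid system without inputs on a state space `E`:
`z ∈ C, ż ∈ F z` and `z ∈ D, z⁺ ∈ G z`. -/
structure HybridSystem (E : Type*) where
  flowSet : Set E
  flowMap : E → Set E
  jumpSet : Set E
  jumpMap : E → Set E

/-- `⋃_{j < J} [t_j, t_{j+1}] × {j}` for some `0 = t_0 ≤ t_1 ≤ ... ≤ t_J`. -/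
def IsCompactHTD (S : Set (ℝ × ℕ)) : Prop :=
  ∃ (J : ℕ) (t : ℕ → ℝ), t 0 = 0 ∧ (∀ j < J, t j ≤ t (j + 1)) ∧
    S = {p | p.2 < J ∧ p.1 ∈ Icc (t p.2) (t (p.2 + 1))}

/-- Hybrid time domains. -/
def IsHTD (S : Set (ℝ × ℕ)) : Prop :=
  (∀ p ∈ S, 0 ≤ p.1) ∧
    ∀ p ∈ S, IsCompactHTD (S ∩ {s | s.1 ∈ Icc 0 p.1 ∧ s.2 ≤ p.2})

/-- A hybrid arc: a function on a nonempty hybrid time domain, locally absolutely continuous on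
each interval `I_j = {t | (t, j) ∈ dom}` (for an `I_j` with empty interior this says nothing).
The values of `val` outside `dom` are irrelevant. -/
structure HybridArc (E : Type*) [NormedAddCommGroup E] where
  dom : Set (ℝ × ℕ)
  val : ℝ → ℕ → E
  isHTD : IsHTD dom
  zero_mem : ((0 : ℝ), (0 : ℕ)) ∈ dom
  locallyAC : ∀ (j : ℕ) (a b : ℝ), (a, j) ∈ dom → (b, j) ∈ dom →
    AbsolutelyContinuousOnInterval (fun t => val t j) a b

/-- The hybrid arc `z` is a solution of the hybrid system `H`. -/
def HybridArc.IsSolution {E : Type*} [NormedAddCommGroup E] [NormedSpace ℝ E]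
    (z : HybridArc E) (H : HybridSystem E) : Prop :=
  z.val 0 0 ∈ H.flowSet ∪ H.jumpSet ∧
  (∀ j : ℕ, (interior {t : ℝ | (t, j) ∈ z.dom}).Nonempty →
    ∀ᵐ t : ℝ, (t, j) ∈ z.dom →
      z.val t j ∈ H.flowSet ∧
        ∃ v ∈ H.flowMap (z.val t j), HasDerivAt (fun s => z.val s j) v t) ∧
  (∀ (t : ℝ) (j : ℕ), (t, j) ∈ z.dom → (t, j + 1) ∈ z.dom →
    z.val t j ∈ H.jumpSet ∧ z.val t (j + 1) ∈ H.jumpMap (z.val t j))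

/-! ### Hybrid systems with a blow-up gain -/

/-- Data `(Ψ_C, F_Ψ, Ψ_D, G_Ψ)` of the `ψ`-part of a hybrid system driven by a blow-up gain `μ`;
the second argument of `flowMap` is `μ`. -/
structure PTData (Ψ : Type*) where
  flowSet : Set Ψ
  flowMap : Ψ → ℝ → Set Ψ
  jumpSet : Set Ψ
  jumpMap : Ψ → Set Ψ

/-- The hybrid system with state `z = (ψ, μ)`, flows
`ψ̇ ∈ μ F_Ψ(ψ, μ)`, `μ̇ = (k / T) μ ^ (1 + 1 / k)` on `Ψ_C × ℝ_{≥ 1}`, and jumps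
`ψ⁺ ∈ G_Ψ(ψ)`, `μ⁺ = μ` on `Ψ_D × ℝ_{≥ 1}`. -/
def PTData.toHybridSystem {Ψ : Type*} [NormedAddCommGroup Ψ] [NormedSpace ℝ Ψ]
    (P : PTData Ψ) (T k : ℝ) : HybridSystem (L2Prod Ψ ℝ) where
  flowSet := {z | z.fst ∈ P.flowSet ∧ 1 ≤ z.snd}
  flowMap z := {v | (∃ w ∈ P.flowMap z.fst z.snd, v.fst = z.snd • w) ∧
    v.snd = k / T * z.snd ^ (1 + 1 / k)}
  jumpSet := {z | z.fst ∈ P.jumpSet ∧ 1 ≤ z.snd}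
  jumpMap z := {w | w.fst ∈ P.jumpMap z.fst ∧ w.snd = z.snd}

/-- The prescribed time `Υ_{T,k} = T μ₀ ^ (-1/k)`. -/
def prescribedTime (T k μ₀ : ℝ) : ℝ := T * μ₀ ^ (-(1 / k))

/-- The blow-up gain `μ_k(t) = T ^ k / (Υ_{T,k} - t) ^ k` started at `μ₀`, on `[0, Υ_{T,k})`. -/
def blowUpGain (T k μ₀ t : ℝ) : ℝ := T ^ k / (prescribedTime T k μ₀ - t) ^ k

/-- `ω_k(b, a)`, with its limit `T (log b - log a)` as `k → 1⁺` for `k = 1`. -/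
def omegaScale (T k b a : ℝ) : ℝ :=
  if k = 1 then T * (Real.log b - Real.log a)
  else T / k * ((b ^ ((k - 1) / k) - 1) / ((k - 1) / k) - (a ^ ((k - 1) / k) - 1) / ((k - 1) / k))

/-- The dilated time `𝒯_k(t) = ω_k(μ_k(t), μ_k(0))` on `[0, Υ_{T,k})`, where `μ_k(0) = μ₀`. -/
def dilatedTime (T k μ₀ t : ℝ) : ℝ := omegaScale T k (blowUpGain T k μ₀ t) μ₀

/-- Class `𝒦ℒ` (functions on `ℝ_{≥ 0} × ℝ_{≥ 0}` with values in `ℝ_{≥ 0}`). -/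
def IsKL (β : ℝ → ℝ → ℝ) : Prop :=
  (∀ r s, 0 ≤ r → 0 ≤ s → 0 ≤ β r s) ∧
  (∀ s, 0 ≤ s → MonotoneOn (fun r => β r s) (Ici 0)) ∧
  (∀ r, 0 ≤ r → AntitoneOn (fun s => β r s) (Ici 0)) ∧
  (∀ s, 0 ≤ s → Tendsto (fun r => β r s) (𝓝[>] 0) (𝓝 0)) ∧
  (∀ r, 0 ≤ r → Tendsto (fun s => β r s) atTop (𝓝 0))

/-- Class `𝒦ℒℒ`. -/
def IsKLL (β : ℝ → ℝ → ℝ → ℝ) : Prop :=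
  ∀ s, 0 ≤ s → IsKL (fun r t => β r s t) ∧ IsKL (fun r t => β r t s)

/-- Prescribed-time stability via flows of the set `A₁ × ℝ_{≥ 1}`, with `A₁` compact. -/
def PTStableViaFlows {Ψ : Type*} [NormedAddCommGroup Ψ] [NormedSpace ℝ Ψ]
    (P : PTData Ψ) (T k : ℝ) (A₁ : Set Ψ) : Prop :=
  IsCompact A₁ ∧
  ∃ β : ℝ → ℝ → ℝ → ℝ, IsKLL β ∧
    ∀ z : HybridArc (L2Prod Ψ ℝ), z.IsSolution (P.toHybridSystem T k) →
      ∀ (t : ℝ) (j : ℕ), (t, j) ∈ z.dom →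
        Metric.infDist (z.val t j) {y | y.fst ∈ A₁ ∧ 1 ≤ y.snd} ≤
          β (Metric.infDist (z.val 0 0) {y | y.fst ∈ A₁ ∧ 1 ≤ y.snd})
            (dilatedTime T k (z.val 0 0).snd t) j

/-! ### Switching systems with resets -/

/-- The mode with index `m`, as an element of `{1, ..., qbar} ⊆ ℝ`. -/
def modeVal {qbar : ℕ} (m : Fin qbar) : ℝ := (m : ℕ) + 1

/-- The set of modes `𝒬 = {1, ..., qbar} ⊆ ℝ`. -/
def modeSet (qbar : ℕ) : Set ℝ := range (modeVal (qbar := qbar))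

/-- The switching system with resets with modes `f_q`, reset maps `R_q` and dwell-time automaton:
state `ψ = (x, τ, q)`, flow map `{f_q(x, τ)} × [0, 1/τ_d] × {0}` on `X × [0, N₀] × 𝒬`, jump map
`{R_q(x)} × {τ - 1} × (𝒬 ∖ {q})` on `X × [1, N₀] × 𝒬`. -/
def switchingData {X : Type*} {qbar : ℕ} (f : Fin qbar → X → ℝ → X) (R : Fin qbar → X → X)
    (τd N₀ : ℝ) : PTData (L2Prod X (L2Prod ℝ ℝ)) where
  flowSet := {ψ | ψ.snd.fst ∈ Icc 0 N₀ ∧ ψ.snd.snd ∈ modeSet qbar}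
  flowMap ψ _ := {v | ∃ m : Fin qbar, ψ.snd.snd = modeVal m ∧
    v.fst = f m ψ.fst ψ.snd.fst ∧ v.snd.fst ∈ Icc 0 (1 / τd) ∧ v.snd.snd = 0}
  jumpSet := {ψ | ψ.snd.fst ∈ Icc 1 N₀ ∧ ψ.snd.snd ∈ modeSet qbar}
  jumpMap ψ := {w | ∃ m : Fin qbar, ψ.snd.snd = modeVal m ∧
    w.fst = R m ψ.fst ∧ w.snd.fst = ψ.snd.fst - 1 ∧
    w.snd.snd ∈ modeSet qbar \ {ψ.snd.snd}}

/-! ### Games -/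

/-- Action profiles of `n` players with scalar actions. -/
abbrev Profile (n : ℕ) := EuclideanSpace ℝ (Fin n)

/-- The profile `x` with the action of player `i` replaced by `y`. -/
def replaceAction {n : ℕ} (x : Profile n) (i : Fin n) (y : ℝ) : Profile n :=
  WithLp.toLp 2 (Function.update (fun l => x l) i y)

/-- `x` is a Nash equilibrium: the cost of each player is the infimum of the costs that the player
can reach by changing only the own action. -/
def IsNashEquilibrium {n : ℕ} (φ : Fin n → Profile n → ℝ) (x : Profile n) : Prop :=
  ∀ i, IsGLB (range fun y : ℝ => φ i (replaceAction x i y)) (φ i x)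

/-- The pseudo-gradient `(∂φ¹/∂x¹, ..., ∂φⁿ/∂xⁿ)`. -/
def pseudoGradient {n : ℕ} (φ : Fin n → Profile n → ℝ) (x : Profile n) : Profile n :=
  WithLp.toLp 2 fun i => fderiv ℝ (φ i) x (EuclideanSpace.single i 1)

/-- `κ`-strong monotonicity. -/
def IsStronglyMonotone {n : ℕ} (κ : ℝ) (g : Profile n → Profile n) : Prop :=
  ∀ x y, κ * ‖x - y‖ ^ 2 ≤ inner ℝ (x - y) (g x - g y)

/-- Global Lipschitz continuity with constant `l`. -/
def IsGloballyLipschitz {n : ℕ} (l : ℝ) (g : Profile n → Profile n) : Prop :=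
  ∀ x y, ‖g x - g y‖ ≤ l * ‖x - y‖

/-- `g` has a Jacobian everywhere, and the maximum singular value of `I - ∂g(x)` is at most `s`. -/
def JacobianRegular {n : ℕ} (s : ℝ) (g : Profile n → Profile n) : Prop :=
  Differentiable ℝ g ∧
    ∀ x, (LinearMap.id - (fderiv ℝ g x : Profile n →ₗ[ℝ] Profile n)).singularValues 0 ≤ s

/-- The affine map `η(τ) = τ (ηhi - ηlo) / N₀ + ηlo`. -/
def eta (ηlo ηhi N₀ τ : ℝ) : ℝ := τ * ((ηhi - ηlo) / N₀) + ηlo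

/-- The momentum vector field
`f_q(x, τ) = ((2 / η(τ)) (x₂ - x₁), -2 η(τ) 𝒢_q(x₁))` for `x = (x₁, x₂)`. -/
def nesField {n qbar : ℕ} (φ : Fin qbar → Fin n → Profile n → ℝ) (ηlo ηhi N₀ : ℝ)
    (q : Fin qbar) (x : L2Prod (Profile n) (Profile n)) (τ : ℝ) :
    L2Prod (Profile n) (Profile n) :=
  WithLp.toLp 2 ((2 / eta ηlo ηhi N₀ τ) • (x.snd - x.fst),
    (-2 * eta ηlo ηhi N₀ τ) • pseudoGradient (φ q) x.fst)

/-- The reset map `R_q(x₁, x₂) = (x₁, x₁)`. -/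
def nesReset {n qbar : ℕ} (_q : Fin qbar) (x : L2Prod (Profile n) (Profile n)) :
    L2Prod (Profile n) (Profile n) :=
  WithLp.toLp 2 (x.fst, x.fst)

/-- The prescribed-time Nash-seeking dynamics with momentum and resets (its `ψ`-part). -/
def nesData {n qbar : ℕ} (φ : Fin qbar → Fin n → Profile n → ℝ) (ηlo ηhi τd N₀ : ℝ) :
    PTData (L2Prod (L2Prod (Profile n) (Profile n)) (L2Prod ℝ ℝ)) :=
  switchingData (nesField φ ηlo ηhi N₀) nesReset τd N₀

/-- The set `{x̃} × {x̃} × [0, N₀] × 𝒬`. -/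
def nesTarget {n : ℕ} (qbar : ℕ) (xt : Profile n) (N₀ : ℝ) :
    Set (L2Prod (L2Prod (Profile n) (Profile n)) (L2Prod ℝ ℝ)) :=
  {ψ | ψ.fst.fst = xt ∧ ψ.fst.snd = xt ∧ ψ.snd.fst ∈ Icc 0 N₀ ∧ ψ.snd.snd ∈ modeSet qbar}

/-- `min_q ζ_q`, where `ζ_q = κ_q / ℓ_q ^ 2`. -/
def zetaMin {qbar : ℕ} (κ l : Fin qbar → ℝ) : ℝ := ⨅ q, κ q / l q ^ 2

/-- The constant `γ̄`, with `ℓ̄ = max_q ℓ_q` and `κ̲ = min_q κ_q`. -/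
def gammaBar {qbar : ℕ} (κ l : Fin qbar → ℝ) (ηlo ηhi N₀ : ℝ) : ℝ :=
  (⨆ q, l q) ^ 2 / (⨅ q, κ q) ^ 2 * (eta ηlo ηhi N₀ (N₀ - 1) ^ 2 / eta ηlo ηhi N₀ 1 ^ 2) +
    1 / (2 * (⨅ q, κ q) ^ 2 * eta ηlo ηhi N₀ 1 ^ 2)

/-- The tuning guidelines. -/
structure TuningGuidelines {qbar : ℕ} (κ l σ : Fin qbar → ℝ) (ηlo ηhi τd N₀ δη δd : ℝ) :
    Prop where
  deltaEta_mem : δη ∈ Ioo (0 : ℝ) 1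
  deltaD_pos : 0 < δd
  sum_mem : δη + δd ∈ Ioo (0 : ℝ) 1
  eta_le : ηhi ^ 2 ≤ δη * (zetaMin κ l / (⨆ q, σ q) ^ 2)
  dwell_le : 1 / τd ≤ δd * (N₀ / (ηhi - ηlo)) * zetaMin κ l
  gammaBar_mem : gammaBar κ l ηlo ηhi N₀ ∈ Ioc (0 : ℝ) 1

/-- The constant `ν`. -/
def nuConst {qbar : ℕ} (κ l σ : Fin qbar → ℝ) (δη δd : ℝ) : ℝ :=
  (1 - δd - δη) * (⨆ q, σ q) ^ 2 / (δη * (1 - δd) * zetaMin κ l + (⨆ q, σ q) ^ 2)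

/-- The lower threshold for the dwell-time parameter `τ_d`. -/
def dwellThreshold {qbar : ℕ} (κ l σ : Fin qbar → ℝ) (ηlo ηhi δη δd : ℝ) : ℝ :=
  max 3 (2 * (1 / (⨅ q, κ q) ^ 2 + ηhi ^ 2)) / (4 * ηlo * nuConst κ l σ δη δd) *
    Real.log (max 3 (2 + 2 * (⨆ q, l q) ^ 2 * ηhi ^ 2) / min 1 (2 * ηlo * (⨅ q, κ q) ^ 2))

end PTNash

end

/-! One Lyapunov function per mode works: `V = |x₂ - x₁|²/4 + |x₂ - x̃|²/4 + η(τ)²|𝒢_q(x₁)|²/2`. The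
weights are such that along the momentum field the cross terms combine into the inner product of
`𝒢_q(x₁)` with `(I - ∂𝒢_q)(x₂ - x₁)`, which the singular value bound controls. Cocoercivity `⟨x₁ -
x̃, 𝒢_q(x₁)⟩ ≥ ζ|𝒢_q(x₁)|²` absorbs the rest, including the growth of `η`, so `V̇ ≤ -c μ V`
(`IsRegularMode.lyapunov_deriv_le`, `exists_decay_rate`). At a jump the condition `γ̄ ≤ 1` makes the
new mode's `V` at the reset point at most the old mode's `V` before it
(`IsRegularMode.lyapunov_reset_le`).

The dilated time `S` grows at rate `μ` along flows and is constant across jumps, since it is a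
function of the gain alone (`dilatedTime_eq`, `hasDerivAt_omegaScale_gain`). Hence `V exp(c S)`
never exceeds a mode-independent multiple of the initial squared distance (`lyapunov_mul_exp_le`).
As `V` is comparable to the squared distance uniformly in the mode, the distance decays like `exp(-c
S / 2)`.

Decay in `j` comes from the timer: `τ + j - S/τ_d` does not increase (`timer_add_le`), so `S ≥ τ_d
(j - N₀)`. Half of the exponent is kept in `S` and half is converted into `j`, which gives an
exponential 𝒦ℒℒ bound (`isKLL_exp`). -/

namespace AbsolutelyContinuousOnInterval

/-! ### Absolutely continuous functions under composition, and monotonicity from derivatives. -/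

theorem lipschitzOn_comp {X Y : Type*} [PseudoMetricSpace X] [PseudoMetricSpace Y]
    {f : ℝ → X} {g : X → Y} {a b : ℝ} {K : NNReal} {s : Set X}
    (hf : AbsolutelyContinuousOnInterval f a b) (hg : LipschitzOnWith K g s)
    (hs : MapsTo f (uIcc a b) s) :
    AbsolutelyContinuousOnInterval (fun t => g (f t)) a b := by
  rw [absolutelyContinuousOnInterval_iff] at hf ⊢
  intro ε hε
  obtain ⟨δ, hδ, h⟩ := hf (ε / (K + 1)) (by positivity)
  refine ⟨δ, hδ, fun E hE hEδ => ?_⟩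
  have h1 := h E hE hEδ
  have h2 : ∑ i ∈ Finset.range E.1, dist (g (f (E.2 i).1)) (g (f (E.2 i).2)) ≤
      ∑ i ∈ Finset.range E.1, (K + 1 : ℝ) * dist (f (E.2 i).1) (f (E.2 i).2) := by
    refine Finset.sum_le_sum fun i hi => ?_
    have hm := hE.1 i hi
    refine (hg.dist_le_mul _ (hs hm.1) _ (hs hm.2)).trans ?_
    gcongr
    linarith
  rw [← Finset.mul_sum] at h2
  have h3 : (K + 1 : ℝ) * (ε / (K + 1)) = ε := by field_simp
  calc _ ≤ _ := h2
    _ < (K + 1 : ℝ) * (ε / (K + 1)) := by gcongr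
    _ = ε := h3

/-- A C¹ map is locally Lipschitz, hence Lipschitz on the compact image of the interval. Regularity
is needed only along the trajectory, which admits powers and logarithms of the positive gain. -/
theorem contDiffAt_comp {E F : Type*} [NormedAddCommGroup E] [NormedSpace ℝ E]
    [NormedAddCommGroup F] [NormedSpace ℝ F] {f : ℝ → E} {g : E → F} {a b : ℝ}
    (hf : AbsolutelyContinuousOnInterval f a b)
    (hg : ∀ t ∈ uIcc a b, ContDiffAt ℝ 1 g (f t)) :
    AbsolutelyContinuousOnInterval (fun t => g (f t)) a b := by
  have hcomp : IsCompact (f '' uIcc a b) := isCompact_uIcc.image_of_continuousOn hf.continuousOn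
  have hloc : LocallyLipschitzOn (f '' uIcc a b) g := by
    rintro _ ⟨t, ht, rfl⟩
    obtain ⟨K, u, hu, hK⟩ := (hg t ht).exists_lipschitzOnWith
    exact ⟨K, u, mem_nhdsWithin_of_mem_nhds hu, hK⟩
  obtain ⟨K, hK⟩ := hloc.exists_lipschitzOnWith_of_compact hcomp
  exact hf.lipschitzOn_comp hK (mapsTo_image _ _)

/-- A real absolutely continuous function with nonpositive derivative almost everywhere does not
increase. -/
theorem le_of_ae_hasDerivAt_nonpos {f : ℝ → ℝ} {a b : ℝ}
    (hf : AbsolutelyContinuousOnInterval f a b) (hab : a ≤ b)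
    (hd : ∀ᵐ t : ℝ, t ∈ Icc a b → ∃ v ≤ 0, HasDerivAt f v t) : f b ≤ f a := by
  rw [← sub_nonpos, ← hf.integral_deriv_eq_sub, ← neg_nonneg, ← intervalIntegral.integral_neg]
  refine intervalIntegral.integral_nonneg_of_ae_restrict hab ?_
  rw [EventuallyLE, ae_restrict_iff' measurableSet_Icc]
  filter_upwards [hd] with t ht hmem
  obtain ⟨v, hv, hv'⟩ := ht hmem
  simpa [hv'.deriv] using hv

end AbsolutelyContinuousOnInterval

/-- A continuous function that is almost everywhere in a closed set stays in this set. -/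
theorem ContinuousOn.mem_of_ae_mem_Icc {E : Type*} [TopologicalSpace E] {f : ℝ → E} {a b : ℝ}
    {C : Set E} (hab : a < b) (hf : ContinuousOn f (Icc a b)) (hC : IsClosed C)
    (h : ∀ᵐ t : ℝ, t ∈ Icc a b → f t ∈ C) {t : ℝ} (ht : t ∈ Icc a b) : f t ∈ C := by
  have hd : Dense {t : ℝ | t ∈ Icc a b → f t ∈ C} := Measure.dense_of_ae h
  have hclosed : IsClosed (Icc a b ∩ f ⁻¹' C) := hf.preimage_isClosed_of_isClosed isClosed_Icc hC
  have hsub : Icc a b ⊆ Icc a b ∩ f ⁻¹' C := by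
    rw [← closure_Ioo hab.ne]
    refine closure_minimal ?_ (by rw [closure_Ioo hab.ne]; exact hclosed)
    -- A conull set is dense, so it is dense in the open interval; closedness of the preimage then
    -- passes to all of `[a, b]`.
    refine (hd.open_subset_closure_inter isOpen_Ioo).trans (closure_minimal ?_ ?_)
    · rintro s ⟨hs, hs'⟩
      rw [closure_Ioo hab.ne]
      exact ⟨Ioo_subset_Icc_self hs, hs' (Ioo_subset_Icc_self hs)⟩
    · rw [closure_Ioo hab.ne]; exact hclosed
  exact (hsub ht).2

/-! ### Induction along hybrid time domains and invariance of the flow set. -/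

namespace PTNash

/-- Truncating the domain at `(t, j)` leaves finitely many intervals, so a property is carried from
`(0, 0)` by alternating flows and jumps. Degenerate intervals are absorbed here, so the flow step
may assume `a < b`. -/
theorem IsHTD.induction {S : Set (ℝ × ℕ)} (hS : IsHTD S) {P : ℝ → ℕ → Prop} (h0 : P 0 0)
    (hflow : ∀ (j : ℕ) (a b : ℝ), a < b → (∀ s ∈ Icc a b, (s, j) ∈ S) → P a j → P b j)
    (hjump : ∀ (t : ℝ) (j : ℕ), (t, j) ∈ S → (t, j + 1) ∈ S → P t j → P t (j + 1))
    {t : ℝ} {j : ℕ} (htj : (t, j) ∈ S) : P t j := by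
  obtain ⟨J, θ, hθ0, hθ, hSθ⟩ := hS.2 _ htj
  have hmem : ∀ s i, i < J → s ∈ Icc (θ i) (θ (i + 1)) → (s, i) ∈ S := fun s i hi hs => by
    have : (s, i) ∈ S ∩ {s | s.1 ∈ Icc 0 t ∧ s.2 ≤ j} := by rw [hSθ]; exact ⟨hi, hs⟩
    exact this.1
  have hself : (t, j) ∈ {p : ℝ × ℕ | p.2 < J ∧ p.1 ∈ Icc (θ p.2) (θ (p.2 + 1))} := by
    rw [← hSθ]; exact ⟨htj, ⟨hS.1 _ htj, le_rfl⟩, le_rfl⟩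
  obtain ⟨hjJ, htθ⟩ := hself
  have hflow' : ∀ i s, i < J → s ∈ Icc (θ i) (θ (i + 1)) → P (θ i) i → P s i := by
    intro i s hi hs hP
    rcases hs.1.eq_or_lt with h | h
    · rwa [← h]
    · exact hflow i _ _ h (fun r hr => hmem r i hi ⟨hr.1, hr.2.trans hs.2⟩) hP
  have hstart : ∀ i, i ≤ j → P (θ i) i := by
    intro i
    induction i with
    | zero => intro _; rwa [hθ0]
    | succ i ih =>
      intro hi
      have hiJ : i < J := by omega
      have hle := hθ i hiJ
      refine hjump _ _ (hmem _ _ hiJ ⟨hle, le_rfl⟩)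
        (hmem _ _ (by omega) ⟨le_rfl, hθ _ (by omega)⟩) ?_
      exact hflow' i _ hiJ ⟨hle, le_rfl⟩ (ih (by omega))
  exact hflow' j t hjJ htθ (hstart j le_rfl)

section Solutions

theorem HybridArc.locallyAC_Icc {E : Type*} [NormedAddCommGroup E] (z : HybridArc E) {j : ℕ} {a b : ℝ} (hab : a ≤ b)
    (hdom : ∀ s ∈ Icc a b, (s, j) ∈ z.dom) :
    AbsolutelyContinuousOnInterval (fun t => z.val t j) a b :=
  z.locallyAC j a b (hdom a ⟨le_rfl, hab⟩) (hdom b ⟨hab, le_rfl⟩)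

variable {E : Type*} [NormedAddCommGroup E] [NormedSpace ℝ E] {H : HybridSystem E}
  {z : HybridArc E}

theorem HybridArc.IsSolution.ae_flow (hz : z.IsSolution H) {j : ℕ} {a b : ℝ} (hab : a < b)
    (hdom : ∀ s ∈ Icc a b, (s, j) ∈ z.dom) :
    ∀ᵐ t : ℝ, t ∈ Icc a b → z.val t j ∈ H.flowSet ∧
      ∃ v ∈ H.flowMap (z.val t j), HasDerivAt (fun s => z.val s j) v t := by
  have hint : (interior {t : ℝ | (t, j) ∈ z.dom}).Nonempty :=
    ⟨(a + b) / 2, mem_interior.2 ⟨Ioo a b, fun s hs => hdom s (Ioo_subset_Icc_self hs), isOpen_Ioo,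
      by constructor <;> linarith⟩⟩
  filter_upwards [hz.2.1 j hint] with t ht hmem
  exact ht (hdom t hmem)

/-- A closed flow set that contains the jump set and the values of the jump map is invariant. -/
theorem HybridArc.IsSolution.mem_flowSet (hz : z.IsSolution H) (hC : IsClosed H.flowSet)
    (hD : H.jumpSet ⊆ H.flowSet) (hG : ∀ x ∈ H.jumpSet, H.jumpMap x ⊆ H.flowSet)
    {t : ℝ} {j : ℕ} (htj : (t, j) ∈ z.dom) : z.val t j ∈ H.flowSet := by
  refine z.isHTD.induction (P := fun t j => z.val t j ∈ H.flowSet) ?_ ?_ ?_ htj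
  · exact hz.1.elim id fun h => hD h
  · intro j a b hab hdom _
    have hac := (z.locallyAC_Icc hab.le hdom).continuousOn
    rw [uIcc_of_le hab.le] at hac
    exact hac.mem_of_ae_mem_Icc hab hC
      ((hz.ae_flow hab hdom).mono fun t ht hmem => (ht hmem).1) (right_mem_Icc.2 hab.le)
  · intro t j h1 h2 _
    obtain ⟨h3, h4⟩ := hz.2.2 t j h1 h2
    exact hG _ h3 h4

end Solutions

end PTNash

/-! ### Singular values, and the pseudo-gradient at an equilibrium. -/

/-- In an orthonormal eigenbasis of `A* A`, `|A x|²` is a sum of squared coordinates weighted by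
squared singular values, and index `0` carries the largest. -/
theorem LinearMap.norm_apply_le_singularValues_zero {E F : Type*} [NormedAddCommGroup E]
    [InnerProductSpace ℝ E] [FiniteDimensional ℝ E] [NormedAddCommGroup F]
    [InnerProductSpace ℝ F] [FiniteDimensional ℝ F] (A : E →ₗ[ℝ] F) (x : E) :
    ‖A x‖ ≤ A.singularValues 0 * ‖x‖ := by
  have hs := A.isSymmetric_adjoint_comp_self
  set b := hs.eigenvectorBasis rfl with hb
  have hx : ‖x‖ ^ 2 = ∑ i, (b.repr x i) ^ 2 := by
    rw [← b.repr.norm_map x, EuclideanSpace.norm_sq_eq]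
    simp
  have hAx : ‖A x‖ ^ 2 = ∑ i, hs.eigenvalues rfl i * (b.repr x i) ^ 2 := by
    have h1 : ‖A x‖ ^ 2 = inner ℝ ((A.adjoint ∘ₗ A) x) x := by
      rw [LinearMap.comp_apply, LinearMap.adjoint_inner_left, real_inner_self_eq_norm_sq]
    rw [h1, ← b.repr.inner_map_map, PiLp.inner_apply]
    refine Finset.sum_congr rfl fun i _ => ?_
    rw [hb, hs.eigenvectorBasis_apply_self_apply rfl x i]
    simp
    ring
  have hle : ‖A x‖ ^ 2 ≤ (A.singularValues 0 * ‖x‖) ^ 2 := by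
    rw [hAx, mul_pow, hx, Finset.mul_sum]
    refine Finset.sum_le_sum fun i _ => ?_
    rw [← A.sq_singularValues_fin rfl i]
    gcongr
    · exact A.singularValues_nonneg _
    · exact A.singularValues_antitone (Nat.zero_le _)
  exact le_of_sq_le_sq hle (mul_nonneg (A.singularValues_nonneg 0) (norm_nonneg x))

namespace PTNash

theorem JacobianRegular.norm_sub_fderiv_le {n : ℕ} {s : ℝ} {g : Profile n → Profile n}
    (hg : JacobianRegular s g) (x v : Profile n) : ‖v - fderiv ℝ g x v‖ ≤ s * ‖v‖ := by
  have h := (LinearMap.id - (fderiv ℝ g x : Profile n →ₗ[ℝ] Profile n)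
    ).norm_apply_le_singularValues_zero v
  exact h.trans (mul_le_mul_of_nonneg_right (hg.2 x) (norm_nonneg v))

/-- The pseudo-gradient vanishes at a Nash equilibrium. -/
theorem IsNashEquilibrium.pseudoGradient_eq_zero {n : ℕ} {φ : Fin n → Profile n → ℝ}
    {x : Profile n} (hφ : ∀ i, Differentiable ℝ (φ i)) (hx : IsNashEquilibrium φ x) :
    pseudoGradient φ x = 0 := by
  ext i
  change fderiv ℝ (φ i) x (EuclideanSpace.single i 1) = 0
  have hline : ∀ y : ℝ, replaceAction x i (x i + y) = x + y • EuclideanSpace.single i 1 := by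
    intro y
    ext l
    by_cases h : l = i
    · subst h; simp [replaceAction]
    · simp [replaceAction, h]
  -- Unilateral deviations of player `i` move along the `i`-th axis, so Fermat's rule applies in one
  -- variable.
  have hmin : IsLocalMin (fun y : ℝ => φ i (x + y • EuclideanSpace.single i (1 : ℝ))) 0 := by
    refine Eventually.of_forall fun y => ?_
    have h := (hx i).1 ⟨x i + y, rfl⟩
    simpa [hline] using h
  have hd : HasDerivAt (fun y : ℝ => φ i (x + y • EuclideanSpace.single i (1 : ℝ)))
      (fderiv ℝ (φ i) x (EuclideanSpace.single i 1)) 0 := by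
    have h1 : HasDerivAt (fun y : ℝ => x + y • EuclideanSpace.single i (1 : ℝ))
        (EuclideanSpace.single i 1) 0 := by
      simpa using ((hasDerivAt_id (0 : ℝ)).smul_const (EuclideanSpace.single i (1 : ℝ))).const_add x
    have h2 : HasFDerivAt (φ i) (fderiv ℝ (φ i) x)
        (x + (0 : ℝ) • EuclideanSpace.single i (1 : ℝ)) := by
      simpa using (hφ i x).hasFDerivAt
    exact h2.comp_hasDerivAt 0 h1
  exact hmin.hasDerivAt_eq_zero hd

end PTNash

/-! ### Derivatives and absolute continuity of components. -/

section L2Components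

variable {α β : Type*} [NormedAddCommGroup α] [NormedSpace ℝ α] [NormedAddCommGroup β]
  [NormedSpace ℝ β] {f : ℝ → PTNash.L2Prod α β}

theorem HasDerivAt.withLp_fst {v : PTNash.L2Prod α β} {t : ℝ} (hf : HasDerivAt f v t) :
    HasDerivAt (fun s => (f s).fst) v.fst t :=
  (WithLp.fstL 2 ℝ α β).hasFDerivAt.comp_hasDerivAt t hf

theorem HasDerivAt.withLp_snd {v : PTNash.L2Prod α β} {t : ℝ} (hf : HasDerivAt f v t) :
    HasDerivAt (fun s => (f s).snd) v.snd t :=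
  (WithLp.sndL 2 ℝ α β).hasFDerivAt.comp_hasDerivAt t hf

theorem AbsolutelyContinuousOnInterval.withLp_fst {a b : ℝ}
    (hf : AbsolutelyContinuousOnInterval f a b) :
    AbsolutelyContinuousOnInterval (fun s => (f s).fst) a b :=
  hf.contDiffAt_comp (g := WithLp.fstL 2 ℝ α β)
    fun _ _ => (WithLp.fstL 2 ℝ α β).contDiff.contDiffAt

theorem AbsolutelyContinuousOnInterval.withLp_snd {a b : ℝ}
    (hf : AbsolutelyContinuousOnInterval f a b) :
    AbsolutelyContinuousOnInterval (fun s => (f s).snd) a b :=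
  hf.contDiffAt_comp (g := WithLp.sndL 2 ℝ α β)
    fun _ _ => (WithLp.sndL 2 ℝ α β).contDiff.contDiffAt

end L2Components

/-! ### The gain, the dilated time and the comparison function. -/

namespace PTNash

/-- The logarithmic and the power branch share one derivative formula, so later arguments need not
separate `k = 1`. -/
theorem hasDerivAt_omegaScale {T k a b : ℝ} (hk : 1 ≤ k) (hb : 0 < b) :
    HasDerivAt (fun b => omegaScale T k b a) (T / k * b ^ (-(1 / k))) b := by
  unfold omegaScale
  split_ifs with h
  · subst h
    have := ((Real.hasDerivAt_log hb.ne').sub_const (Real.log a)).const_mul T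
    simpa [Real.rpow_neg_one] using this
  · have hk1 : (k - 1) / k ≠ 0 := div_ne_zero (sub_ne_zero.2 h) (by positivity)
    have := (((((Real.hasDerivAt_rpow_const (p := (k - 1) / k) (Or.inl hb.ne')).sub_const 1
      ).div_const ((k - 1) / k)).sub_const ((a ^ ((k - 1) / k) - 1) / ((k - 1) / k)))).const_mul
      (T / k)
    convert! this using 1
    rw [mul_div_cancel_left₀ _ hk1]
    congr 2
    field_simp
    ring

theorem contDiffAt_omegaScale {T k a b : ℝ} (hb : 0 < b) :
    ContDiffAt ℝ 1 (fun b => omegaScale T k b a) b := by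
  unfold omegaScale
  split_ifs with h
  · exact contDiffAt_const.mul ((Real.contDiffAt_log.2 hb.ne').sub contDiffAt_const)
  · exact contDiffAt_const.mul ((((Real.contDiffAt_rpow_const_of_ne hb.ne').sub
      contDiffAt_const).div_const _).sub contDiffAt_const)

theorem omegaScale_self (T k a : ℝ) : omegaScale T k a a = 0 := by
  unfold omegaScale
  split_ifs <;> simp

section Gain

variable {Ψ : Type*} [NormedAddCommGroup Ψ] [NormedSpace ℝ Ψ] {P : PTData Ψ} {T k : ℝ}
  {z : HybridArc (L2Prod Ψ ℝ)}

/-- The substitution `μ ^ (-1/k)` linearises the gain equation: it decreases at the constant rate `1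
/ T` along flows, and jumps keep `μ`. -/
theorem gain_rpow_eq (hT : 0 < T) (hk : 1 ≤ k) (hz : z.IsSolution (P.toHybridSystem T k))
    (hone : ∀ t j, (t, j) ∈ z.dom → 1 ≤ (z.val t j).snd) {t : ℝ} {j : ℕ} (htj : (t, j) ∈ z.dom) :
    (z.val t j).snd ^ (-(1 / k)) + t / T = (z.val 0 0).snd ^ (-(1 / k)) := by
  refine z.isHTD.induction
    (P := fun t j => (z.val t j).snd ^ (-(1 / k)) + t / T = (z.val 0 0).snd ^ (-(1 / k)))
    (by simp) ?_ ?_ htj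
  · intro j a b hab hdom hP
    have hpos : ∀ s ∈ Icc a b, 0 < (z.val s j).snd := fun s hs =>
      zero_lt_one.trans_le (hone s j (hdom s hs))
    have hac : AbsolutelyContinuousOnInterval
        (fun s => (z.val s j).snd ^ (-(1 / k)) + s / T) a b := by
      refine AbsolutelyContinuousOnInterval.add ?_ ?_
      · refine (z.locallyAC_Icc hab.le hdom).withLp_snd.contDiffAt_comp
          (g := fun y : ℝ => y ^ (-(1 / k))) fun s hs => ?_
        rw [uIcc_of_le hab.le] at hs
        exact Real.contDiffAt_rpow_const_of_ne (hpos s hs).ne'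
      · exact (contDiff_id.div_const T).contDiffOn.absolutelyContinuousOnInterval
    have hder : ∀ᵐ s : ℝ, s ∈ uIcc a b →
        HasDerivAt (fun s => (z.val s j).snd ^ (-(1 / k)) + s / T) 0 s := by
      rw [uIcc_of_le hab.le]
      filter_upwards [hz.ae_flow hab hdom] with s hs hmem
      obtain ⟨-, v, ⟨-, hv⟩, hd⟩ := hs hmem
      have hm := hpos s hmem
      have h1 := (hd.withLp_snd.rpow_const (p := -(1 / k)) (Or.inl hm.ne')).add
        ((hasDerivAt_id s).div_const T)
      convert! h1 using 1
      have h2 : (z.val s j).snd ^ (1 + 1 / k) * (z.val s j).snd ^ (-(1 / k) - 1) = 1 := by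
        rw [← Real.rpow_add hm]
        ring_nf
        simp
      rw [hv]
      have hk0 : k ≠ 0 := by positivity
      calc (0 : ℝ) = -(1 / T) * 1 + 1 / T := by ring
        _ = -(1 / T) * ((z.val s j).snd ^ (1 + 1 / k) * (z.val s j).snd ^ (-(1 / k) - 1))
            + 1 / T := by rw [h2]
        _ = _ := by field_simp
    obtain ⟨C, hC⟩ := hac.const_of_ae_hasDerivAt_zero hder
    have := (hC b right_mem_uIcc).trans (hC a left_mem_uIcc).symm
    rw [this, hP]
  · intro t j h1 h2 hP
    have h := (hz.2.2 t j h1 h2).2.2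
    rwa [h]

/-- The explicit blow-up gain equals the gain component of the solution, so the dilated time can be
differentiated through the state. -/
theorem dilatedTime_eq (hT : 0 < T) (hk : 1 ≤ k) (hz : z.IsSolution (P.toHybridSystem T k))
    (hone : ∀ t j, (t, j) ∈ z.dom → 1 ≤ (z.val t j).snd) {t : ℝ} {j : ℕ} (htj : (t, j) ∈ z.dom) :
    dilatedTime T k (z.val 0 0).snd t = omegaScale T k (z.val t j).snd (z.val 0 0).snd := by
  have hm : 0 < (z.val t j).snd := zero_lt_one.trans_le (hone t j htj)
  have h := gain_rpow_eq hT hk hz hone htj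
  have h1 : prescribedTime T k (z.val 0 0).snd - t = T * (z.val t j).snd ^ (-(1 / k)) := by
    rw [prescribedTime, ← h]
    field_simp
    ring
  have hk0 : k ≠ 0 := by positivity
  have hTk : T ^ k ≠ 0 := (Real.rpow_pos_of_pos hT k).ne'
  have h2 : blowUpGain T k (z.val 0 0).snd t = (z.val t j).snd := by
    rw [blowUpGain, h1, Real.mul_rpow hT.le (by positivity), ← Real.rpow_mul hm.le]
    have h3 : -(1 / k) * k = -1 := by field_simp
    rw [h3, Real.rpow_neg_one]
    field_simp
  rw [dilatedTime, h2]

/-- Along flows the dilated time grows at the rate `μ`. -/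
theorem hasDerivAt_omegaScale_gain (hT : 0 < T) (hk : 1 ≤ k) {m : ℝ → ℝ} {t a : ℝ} (hm : 0 < m t)
    (hd : HasDerivAt m (k / T * m t ^ (1 + 1 / k)) t) :
    HasDerivAt (fun s => omegaScale T k (m s) a) (m t) t := by
  have h := (hasDerivAt_omegaScale (T := T) (a := a) hk hm).comp t hd
  convert! h using 1
  have h2 : m t ^ (-(1 / k)) * m t ^ (1 + 1 / k) = m t := by
    rw [← Real.rpow_add hm]
    ring_nf
    simp
  have hk0 : k ≠ 0 := by positivity
  calc m t = m t ^ (-(1 / k)) * m t ^ (1 + 1 / k) := h2.symm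
    _ = _ := by field_simp

end Gain

/-- The two time arguments play symmetric roles: freezing either one contributes only a constant `u`
to the exponent. -/
theorem isKLL_exp {C a b : ℝ} (hC : 0 ≤ C) (ha : 0 < a) (hb : 0 < b) :
    IsKLL fun r s t => C * r * Real.exp (-(a * s) - b * t) := by
  have key : ∀ c u : ℝ, 0 < c →
      IsKL fun r s => C * r * Real.exp (-(c * s) - u) := by
    intro c u hc
    refine ⟨fun r s hr _ => by positivity, fun s _ r hr r' _ h => ?_, fun r hr s _ s' _ h => ?_,
      fun s _ => ?_, fun r _ => ?_⟩
    · dsimp only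
      gcongr
    · have : (0 : ℝ) ≤ r := hr
      dsimp only
      gcongr
    · have : Continuous fun r : ℝ => C * r * Real.exp (-(c * s) - u) := by fun_prop
      have h := (this.tendsto 0).mono_left (nhdsWithin_le_nhds (s := Ioi 0))
      simpa using h
    · have h1 : Tendsto (fun s : ℝ => -(c * s) - u) atTop atBot :=
        tendsto_atBot_add_const_right _ (-u)
          (tendsto_neg_atTop_atBot.comp (tendsto_id.const_mul_atTop hc))
      simpa using (Real.tendsto_exp_atBot.comp h1).const_mul (C * r)
  intro s _
  refine ⟨?_, key a (b * s) ha⟩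
  convert key b (a * s) hb using 5
  ring

end PTNash

/-! ### The Lyapunov function: bounds, decrease along the field, resets. -/

namespace PTNash

/-- Bounds on a pseudo-gradient that vanishes at `xt`, in the form used by the Lyapunov analysis. -/
structure IsRegularMode {n : ℕ} (κ L σ ζ : ℝ) (xt : Profile n) (g : Profile n → Profile n) :
    Prop where
  differentiable : Differentiable ℝ g
  lower : ∀ x, κ * ‖x - xt‖ ≤ ‖g x‖
  upper : ∀ x, ‖g x‖ ≤ L * ‖x - xt‖
  coercive : ∀ x, ζ * ‖g x‖ ^ 2 ≤ inner ℝ (x - xt) (g x)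
  jacobian : ∀ x v, ‖v - fderiv ℝ g x v‖ ≤ σ * ‖v‖

/-- Strong monotonicity and the Lipschitz bound together give cocoercivity with constant `κ / l²`.
The constants are relaxed to `κ'`, `L`, `σ'`, `ζ` so that all modes can share the same ones. -/
theorem isRegularMode_of_isStronglyMonotone {n : ℕ} {κ l σ κ' L σ' ζ : ℝ} {xt : Profile n}
    {g : Profile n → Profile n} (hκ : 0 < κ) (hl : 0 < l) (hmono : IsStronglyMonotone κ g)
    (hlip : IsGloballyLipschitz l g) (hjac : JacobianRegular σ g) (hxt : g xt = 0)
    (hκ' : κ' ≤ κ) (hL : l ≤ L) (hσ : σ ≤ σ') (hζ : ζ ≤ κ / l ^ 2) :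
    IsRegularMode κ' L σ' ζ xt g := by
  have hm : ∀ x, κ * ‖x - xt‖ ^ 2 ≤ inner ℝ (x - xt) (g x) := fun x => by
    simpa [hxt] using hmono x xt
  have hu : ∀ x, ‖g x‖ ≤ l * ‖x - xt‖ := fun x => by simpa [hxt] using hlip x xt
  refine ⟨hjac.1, fun x => ?_, fun x => ?_, fun x => ?_, fun x v => ?_⟩
  · refine (mul_le_mul_of_nonneg_right hκ' (norm_nonneg _)).trans ?_
    rcases (norm_nonneg (x - xt)).eq_or_lt with h | h
    · rw [← h]; simp
    · have h1 := (hm x).trans (real_inner_le_norm _ _)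
      refine le_of_mul_le_mul_left ?_ h
      calc ‖x - xt‖ * (κ * ‖x - xt‖) = κ * ‖x - xt‖ ^ 2 := by ring
        _ ≤ _ := h1
  · exact (hu x).trans (by gcongr)
  · calc ζ * ‖g x‖ ^ 2 ≤ κ / l ^ 2 * (l * ‖x - xt‖) ^ 2 := by
          gcongr
          exact hu x
      _ = κ * ‖x - xt‖ ^ 2 := by field_simp
      _ ≤ _ := hm x
  · exact (hjac.norm_sub_fderiv_le x v).trans (by gcongr)

/-- The Lyapunov function `|x₂ - x₁|² / 4 + |x₂ - x̃|² / 4 + η² |g(x₁)|² / 2`. -/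
noncomputable def lyapunov {n : ℕ} (g : Profile n → Profile n) (xt : Profile n) (η : ℝ)
    (x₁ x₂ : Profile n) : ℝ :=
  1 / 4 * ‖x₂ - x₁‖ ^ 2 + 1 / 4 * ‖x₂ - xt‖ ^ 2 + η ^ 2 / 2 * ‖g x₁‖ ^ 2

theorem AbsolutelyContinuousOnInterval.lyapunov {n : ℕ} {g : Profile n → Profile n}
    {xt : Profile n} {l a b : ℝ} {x₁ x₂ : ℝ → Profile n} {η : ℝ → ℝ}
    (hg : IsGloballyLipschitz l g)
    (h₁ : AbsolutelyContinuousOnInterval x₁ a b) (h₂ : AbsolutelyContinuousOnInterval x₂ a b)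
    (hη : AbsolutelyContinuousOnInterval η a b) :
    AbsolutelyContinuousOnInterval (fun t => lyapunov g xt (η t) (x₁ t) (x₂ t)) a b := by
  have hsq : ∀ {f : ℝ → Profile n}, AbsolutelyContinuousOnInterval f a b →
      AbsolutelyContinuousOnInterval (fun t => ‖f t‖ ^ 2) a b := fun hf =>
    hf.contDiffAt_comp (g := fun y => ‖y‖ ^ 2) fun _ _ => (contDiff_norm_sq ℝ).contDiffAt
  -- The map `g` need not be C¹, so absolute continuity comes from its Lipschitz bound.
  have hgx : AbsolutelyContinuousOnInterval (fun t => g (x₁ t)) a b :=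
    h₁.lipschitzOn_comp (K := l.toNNReal) (s := univ)
      ((LipschitzWith.of_dist_le_mul fun x y => by
        rw [dist_eq_norm, dist_eq_norm]
        exact (hg x y).trans
          (mul_le_mul_of_nonneg_right (Real.le_coe_toNNReal l) (norm_nonneg _))).lipschitzOnWith)
      (mapsTo_univ _ _)
  have hx : AbsolutelyContinuousOnInterval (fun t => x₂ t - xt) a b :=
    h₂.contDiffAt_comp (g := fun y => y - xt) fun _ _ => (contDiff_id.sub contDiff_const).contDiffAt
  have hη2 : AbsolutelyContinuousOnInterval (fun t => η t ^ 2 / 2) a b :=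
    hη.contDiffAt_comp (g := fun y : ℝ => y ^ 2 / 2)
      fun _ _ => ((contDiff_id.pow 2).div_const 2).contDiffAt
  exact (((hsq (h₂.sub h₁)).const_mul (1 / 4)).add ((hsq hx).const_mul (1 / 4))).add
    (hη2.mul (hsq hgx))

theorem HasDerivAt.lyapunov {n : ℕ} {g : Profile n → Profile n} {xt : Profile n} {t : ℝ}
    {x₁ x₂ : ℝ → Profile n} {η : ℝ → ℝ} {u₁ u₂ : Profile n} {e : ℝ}
    (hg : Differentiable ℝ g) (h₁ : HasDerivAt x₁ u₁ t) (h₂ : HasDerivAt x₂ u₂ t)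
    (hη : HasDerivAt η e t) :
    HasDerivAt (fun t => lyapunov g xt (η t) (x₁ t) (x₂ t))
      (1 / 2 * inner ℝ (x₂ t - x₁ t) (u₂ - u₁) + 1 / 2 * inner ℝ (x₂ t - xt) u₂ +
        η t * e * ‖g (x₁ t)‖ ^ 2 + η t ^ 2 * inner ℝ (g (x₁ t)) (fderiv ℝ g (x₁ t) u₁)) t := by
  have hgx : HasDerivAt (fun t => g (x₁ t)) (fderiv ℝ g (x₁ t) u₁) t :=
    (hg (x₁ t)).hasFDerivAt.comp_hasDerivAt t h₁
  have h := (((h₂.sub h₁).norm_sq.const_mul (1 / 4)).add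
    ((h₂.sub_const xt).norm_sq.const_mul (1 / 4))).add
    (((hη.pow 2).div_const 2).mul hgx.norm_sq)
  convert! h using 1
  simp
  ring

/-- Quadratic-form bound behind the decrease of the Lyapunov function. -/
theorem exists_decay_rate {ηlo ηhi δη δd σ ζ κ : ℝ} (hηlo : 0 < ηlo) (hηhi : ηlo < ηhi)
    (hδη : 0 < δη) (hsum : δη + δd < 1) (hσ : 0 < σ) (hζ : 0 < ζ) (hκ : 0 < κ)
    (hη : ηhi ^ 2 ≤ δη * (ζ / σ ^ 2)) :
    ∃ c > 0, ∀ η ∈ Icc ηlo ηhi, ∀ a b : ℝ,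
      -(1 / η) * a ^ 2 + 2 * η * σ * (a * b) - η * ((1 - δd) * ζ) * b ^ 2 ≤
        -c * (3 / 4 * a ^ 2 + (1 / (2 * κ ^ 2) + η ^ 2 / 2) * b ^ 2) := by
  have hd : 0 < 1 - δd := by linarith
  -- `θ` is the share of the `a²` term spent on the cross term by Young's inequality. `θ < 1` leaves
  -- some `a²`; `θ > δη / (1 - δd)` leaves some `b²`.
  obtain ⟨θ, hθ1, hθ2⟩ := exists_between (show δη / (1 - δd) < 1 by rw [div_lt_one hd]; linarith)
  have hθ : 0 < θ := lt_trans (by positivity) hθ1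
  have hB : 0 < 1 - δd - δη / θ := by
    rw [div_lt_iff₀ hd] at hθ1
    rw [sub_pos, div_lt_iff₀ hθ]
    linarith
  have hhi : 0 < ηhi := hηlo.trans hηhi
  set A := (1 - θ) / ηhi with hA
  set B := ηlo * ζ * (1 - δd - δη / θ) with hBd
  have hA0 : 0 < A := div_pos (by linarith) hhi
  have hB0 : 0 < B := by positivity
  set M := 1 / (2 * κ ^ 2) + ηhi ^ 2 / 2 with hM
  have hM0 : 0 < M := by positivity
  -- `A` and `B` bound the leftover coefficients from below for all `η`; `3/4` and `M` bound those
  -- to be dominated from above.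
  refine ⟨min (A * (4 / 3)) (B / M), lt_min (by positivity) (by positivity), ?_⟩
  rintro η ⟨h1, h2⟩ a b
  have hη0 : 0 < η := hηlo.trans_le h1
  have hσζ : η ^ 2 * σ ^ 2 ≤ δη * ζ := by
    calc η ^ 2 * σ ^ 2 ≤ ηhi ^ 2 * σ ^ 2 := by gcongr
      _ ≤ δη * (ζ / σ ^ 2) * σ ^ 2 := by gcongr
      _ = δη * ζ := by field_simp
  have hyoung : 2 * η * σ * (a * b) ≤ θ / η * a ^ 2 + η * (δη / θ * ζ) * b ^ 2 := by
    have hs : 0 ≤ η / θ * (θ / η * a - η * σ * b) ^ 2 := by positivity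
    have he : η / θ * (θ / η * a - η * σ * b) ^ 2 =
        θ / η * a ^ 2 - 2 * η * σ * (a * b) + η / θ * (η ^ 2 * σ ^ 2) * b ^ 2 := by
      field_simp
      ring
    have hl : η / θ * (η ^ 2 * σ ^ 2) * b ^ 2 ≤ η / θ * (δη * ζ) * b ^ 2 := by gcongr
    have he2 : η / θ * (δη * ζ) * b ^ 2 = η * (δη / θ * ζ) * b ^ 2 := by ring
    linarith
  have hA2 : A * a ^ 2 ≤ (1 - θ) / η * a ^ 2 := by
    rw [hA]
    have : 0 ≤ 1 - θ := by linarith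
    gcongr
  have hB2 : B * b ^ 2 ≤ η * ζ * (1 - δd - δη / θ) * b ^ 2 := by
    rw [hBd]
    gcongr
  have hca : min (A * (4 / 3)) (B / M) * (3 / 4 * a ^ 2) ≤ A * a ^ 2 := by
    calc _ ≤ A * (4 / 3) * (3 / 4 * a ^ 2) := by gcongr; exact min_le_left _ _
      _ = _ := by ring
  have hcb : min (A * (4 / 3)) (B / M) * ((1 / (2 * κ ^ 2) + η ^ 2 / 2) * b ^ 2) ≤ B * b ^ 2 := by
    calc _ ≤ B / M * (M * b ^ 2) := by
          rw [hM]
          gcongr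
          exact min_le_right _ _
      _ = _ := by field_simp
  have e1 : -(1 / η) * a ^ 2 + 2 * η * σ * (a * b) - η * ((1 - δd) * ζ) * b ^ 2 ≤
      -((1 - θ) / η * a ^ 2) - η * ζ * (1 - δd - δη / θ) * b ^ 2 := by
    have : -((1 - θ) / η * a ^ 2) - η * ζ * (1 - δd - δη / θ) * b ^ 2 =
      -(1 / η) * a ^ 2 + (θ / η * a ^ 2 + η * (δη / θ * ζ) * b ^ 2)
        - η * ((1 - δd) * ζ) * b ^ 2 := by ring
    linarith
  linarith

section Bounds

variable {n : ℕ} {κ L σ ζ : ℝ} {xt : Profile n} {g : Profile n → Profile n}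

theorem norm_add_sq_le_two_mul {E : Type*} [SeminormedAddCommGroup E] (x y : E) :
    ‖x + y‖ ^ 2 ≤ 2 * ‖x‖ ^ 2 + 2 * ‖y‖ ^ 2 := by
  have h := norm_add_le x y
  have h0 := norm_nonneg (x + y)
  nlinarith [sq_nonneg (‖x‖ - ‖y‖)]

/-- Expresses `V` in `|x₂ - x₁|` and `|g(x₁)|`, the two quantities that the flow dissipates: the
lower bound on `g` trades `|x₁ - x̃|` for `|g(x₁)|`. -/
theorem IsRegularMode.lyapunov_le (hg : IsRegularMode κ L σ ζ xt g) (hκ : 0 < κ) (η : ℝ)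
    (x₁ x₂ : Profile n) :
    lyapunov g xt η x₁ x₂ ≤
      3 / 4 * ‖x₂ - x₁‖ ^ 2 + (1 / (2 * κ ^ 2) + η ^ 2 / 2) * ‖g x₁‖ ^ 2 := by
  have h1 : ‖x₂ - xt‖ ^ 2 ≤ 2 * ‖x₂ - x₁‖ ^ 2 + 2 * ‖x₁ - xt‖ ^ 2 := by
    simpa using norm_add_sq_le_two_mul (x₂ - x₁) (x₁ - xt)
  have h2 : ‖x₁ - xt‖ ^ 2 ≤ 1 / κ ^ 2 * ‖g x₁‖ ^ 2 := by
    have h := pow_le_pow_left₀ (by positivity) (hg.lower x₁) 2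
    rw [div_mul_eq_mul_div, le_div_iff₀ (by positivity)]
    nlinarith
  have h3 : 1 / (2 * κ ^ 2) = 1 / 2 * (1 / κ ^ 2) := by field_simp
  unfold lyapunov
  rw [h3]
  linarith

theorem IsRegularMode.lyapunov_le_mul_norm_sq (hg : IsRegularMode κ L σ ζ xt g)
    {η ηhi : ℝ} (hη : 0 ≤ η) (hηhi : η ≤ ηhi) (x₁ x₂ : Profile n) :
    lyapunov g xt η x₁ x₂ ≤
      (3 / 4 + ηhi ^ 2 * L ^ 2 / 2) * (‖x₁ - xt‖ ^ 2 + ‖x₂ - xt‖ ^ 2) := by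
  have h1 : ‖x₂ - x₁‖ ^ 2 ≤ 2 * ‖x₂ - xt‖ ^ 2 + 2 * ‖x₁ - xt‖ ^ 2 := by
    have := norm_add_sq_le_two_mul (x₂ - xt) (xt - x₁)
    rwa [sub_add_sub_cancel, norm_sub_rev xt] at this
  have h2 : η ^ 2 / 2 * ‖g x₁‖ ^ 2 ≤ ηhi ^ 2 / 2 * (L * ‖x₁ - xt‖) ^ 2 := by
    gcongr
    exact hg.upper x₁
  have h3 : 0 ≤ ηhi ^ 2 * L ^ 2 / 2 * ‖x₂ - xt‖ ^ 2 := by positivity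
  have h4 : 0 ≤ ‖x₁ - xt‖ ^ 2 := by positivity
  unfold lyapunov
  linarith

theorem IsRegularMode.mul_norm_sq_le_lyapunov (hg : IsRegularMode κ L σ ζ xt g) (hκ : 0 < κ)
    {η ηlo : ℝ} (hηlo : 0 < ηlo) (hη : ηlo ≤ η) (x₁ x₂ : Profile n) :
    min (1 / 4) (ηlo ^ 2 * κ ^ 2 / 2) * (‖x₁ - xt‖ ^ 2 + ‖x₂ - xt‖ ^ 2) ≤
      lyapunov g xt η x₁ x₂ := by
  have h1 : ηlo ^ 2 / 2 * (κ * ‖x₁ - xt‖) ^ 2 ≤ η ^ 2 / 2 * ‖g x₁‖ ^ 2 := by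
    gcongr
    exact hg.lower x₁
  have h2 := mul_le_mul_of_nonneg_right (min_le_left (1 / 4) (ηlo ^ 2 * κ ^ 2 / 2))
    (sq_nonneg ‖x₂ - xt‖)
  have h3 := mul_le_mul_of_nonneg_right (min_le_right (1 / 4) (ηlo ^ 2 * κ ^ 2 / 2))
    (sq_nonneg ‖x₁ - xt‖)
  have h4 : 0 ≤ ‖x₂ - x₁‖ ^ 2 := by positivity
  unfold lyapunov
  linarith

/-- A reset does not increase the Lyapunov function, even when the mode changes. -/
theorem IsRegularMode.lyapunov_reset_le {g' : Profile n → Profile n}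
    (hg : IsRegularMode κ L σ ζ xt g) (hg' : IsRegularMode κ L σ ζ xt g') (hκ : 0 < κ)
    {η η' : ℝ} (hη : L ^ 2 / κ ^ 2 * η' ^ 2 + 1 / (2 * κ ^ 2) ≤ η ^ 2)
    (x₁ x₂ : Profile n) : lyapunov g' xt η' x₁ x₁ ≤ lyapunov g xt η x₁ x₂ := by
  have h2 : ‖x₁ - xt‖ ^ 2 ≤ 1 / κ ^ 2 * ‖g x₁‖ ^ 2 := by
    have h := pow_le_pow_left₀ (by positivity) (hg.lower x₁) 2
    rw [div_mul_eq_mul_div, le_div_iff₀ (by positivity)]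
    nlinarith
  have h3 : ‖g' x₁‖ ^ 2 ≤ L ^ 2 * ‖x₁ - xt‖ ^ 2 := by
    rw [← mul_pow]
    gcongr
    exact hg'.upper x₁
  have h4 : η' ^ 2 / 2 * ‖g' x₁‖ ^ 2 ≤ η' ^ 2 / 2 * (L ^ 2 * (1 / κ ^ 2 * ‖g x₁‖ ^ 2)) := by
    gcongr
    exact h3.trans (by gcongr)
  -- The `L² / κ²` part of `hη` pays for the gradient term of the new mode, the `1 / (2κ²)` part for
  -- `|x₁ - x̃|² / 4`, the new value of the second term of `V`.
  have h5 := mul_le_mul_of_nonneg_right hη (sq_nonneg ‖g x₁‖)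
  have h6 : (L ^ 2 / κ ^ 2 * η' ^ 2 + 1 / (2 * κ ^ 2)) * ‖g x₁‖ ^ 2 =
    2 * (η' ^ 2 / 2 * (L ^ 2 * (1 / κ ^ 2 * ‖g x₁‖ ^ 2))) + 1 / 2 * (1 / κ ^ 2 * ‖g x₁‖ ^ 2) := by
    field_simp
  have h7 : 0 ≤ ‖x₂ - x₁‖ ^ 2 := by positivity
  have h8 : 0 ≤ ‖x₂ - xt‖ ^ 2 := by positivity
  unfold lyapunov
  rw [sub_self, norm_zero]
  linarith

/-- Decrease of the Lyapunov function along the momentum field. -/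
theorem IsRegularMode.lyapunov_deriv_le (hg : IsRegularMode κ L σ ζ xt g) (hκ : 0 < κ)
    {c δd η e m : ℝ} (hc : 0 < c) (hη : 0 < η) (hm : 0 ≤ m) (he : e ≤ δd * ζ)
    (hdecay : ∀ a b : ℝ,
      -(1 / η) * a ^ 2 + 2 * η * σ * (a * b) - η * ((1 - δd) * ζ) * b ^ 2 ≤
        -c * (3 / 4 * a ^ 2 + (1 / (2 * κ ^ 2) + η ^ 2 / 2) * b ^ 2))
    (x₁ x₂ : Profile n) :
    1 / 2 * inner ℝ (x₂ - x₁) (m • (-2 * η) • g x₁ - m • (2 / η) • (x₂ - x₁)) +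
        1 / 2 * inner ℝ (x₂ - xt) (m • (-2 * η) • g x₁) + η * (m * e) * ‖g x₁‖ ^ 2 +
        η ^ 2 * inner ℝ (g x₁) (fderiv ℝ g x₁ (m • (2 / η) • (x₂ - x₁))) ≤
      -c * m * lyapunov g xt η x₁ x₂ := by
  have hx : x₂ - xt = (x₂ - x₁) + (x₁ - xt) := by abel
  set d := x₂ - x₁ with hd
  -- Both quarter-weighted terms contribute `-η⟨d, g⟩`, and the derivative of `g(x₁)` contributes
  -- `2η⟨g, ∂g d⟩`; together they form `⟨g, d - ∂g d⟩`.
  have hexp : 1 / 2 * inner ℝ d (m • (-2 * η) • g x₁ - m • (2 / η) • d) +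
        1 / 2 * inner ℝ (x₂ - xt) (m • (-2 * η) • g x₁) + η * (m * e) * ‖g x₁‖ ^ 2 +
        η ^ 2 * inner ℝ (g x₁) (fderiv ℝ g x₁ (m • (2 / η) • d)) =
      m * (-(1 / η) * ‖d‖ ^ 2 - 2 * η * inner ℝ (g x₁) (d - fderiv ℝ g x₁ d) -
        η * inner ℝ (x₁ - xt) (g x₁) + η * e * ‖g x₁‖ ^ 2) := by
    rw [hx]
    simp only [inner_sub_right, inner_smul_right, inner_add_left, map_smul,
      real_inner_self_eq_norm_sq, real_inner_comm d (g x₁)]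
    field_simp
    ring
  have hcs : -(inner ℝ (g x₁) (d - fderiv ℝ g x₁ d)) ≤ σ * (‖d‖ * ‖g x₁‖) := by
    rw [← inner_neg_right]
    refine (real_inner_le_norm _ _).trans ?_
    rw [norm_neg]
    calc _ ≤ ‖g x₁‖ * (σ * ‖d‖) := by gcongr; exact hg.jacobian x₁ d
      _ = _ := by ring
  have h1 := mul_le_mul_of_nonneg_left hcs (show 0 ≤ 2 * η by positivity)
  have h2 := mul_le_mul_of_nonneg_left (hg.coercive x₁) hη.le
  have h3 : η * e * ‖g x₁‖ ^ 2 ≤ η * (δd * ζ) * ‖g x₁‖ ^ 2 := by gcongr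
  have h4 := hdecay ‖d‖ ‖g x₁‖
  have h5 := mul_le_mul_of_nonneg_left (hg.lyapunov_le hκ η x₁ x₂) hc.le
  rw [hexp]
  calc _ ≤ m * (-c * lyapunov g xt η x₁ x₂) := by
        refine mul_le_mul_of_nonneg_left ?_ hm
        rw [← hd] at h5
        linarith
    _ = _ := by ring

end Bounds

end PTNash

/-! ### Modes, timer, flow set and distance to the target. -/

namespace PTNash

theorem modeVal_injective {qbar : ℕ} : Function.Injective (modeVal (qbar := qbar)) := by
  intro a b h
  have : ((a : ℕ) : ℝ) = (b : ℕ) := by simpa [modeVal] using h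
  exact Fin.ext (by exact_mod_cast this)

theorem isClosed_modeSet (qbar : ℕ) : IsClosed (modeSet qbar) := (finite_range _).isClosed

section Eta

variable {ηlo ηhi N₀ τ τ' : ℝ}

theorem eta_mono (hη : ηlo < ηhi) (hN₀ : 0 < N₀) (h : τ ≤ τ') :
    eta ηlo ηhi N₀ τ ≤ eta ηlo ηhi N₀ τ' := by
  have : 0 ≤ (ηhi - ηlo) / N₀ := div_nonneg (by linarith) hN₀.le
  unfold eta
  gcongr

theorem eta_mem_Icc (hη : ηlo < ηhi) (hN₀ : 0 < N₀) (hτ : τ ∈ Icc 0 N₀) :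
    eta ηlo ηhi N₀ τ ∈ Icc ηlo ηhi := by
  have h0 : eta ηlo ηhi N₀ 0 = ηlo := by simp [eta]
  have h1 : eta ηlo ηhi N₀ N₀ = ηhi := by
    unfold eta
    field_simp
    ring
  exact ⟨h0.symm.le.trans (eta_mono hη hN₀ hτ.1), (eta_mono hη hN₀ hτ.2).trans h1.le⟩

end Eta

section Domain

variable {n qbar : ℕ} {φ : Fin qbar → Fin n → Profile n → ℝ} {xt : Profile n}
  {T k N₀ τd ηlo ηhi : ℝ}

theorem isClosed_nesFlowSet :
    IsClosed ((nesData φ ηlo ηhi τd N₀).toHybridSystem T k).flowSet := by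
  have h1 : Continuous fun z : L2Prod (L2Prod (L2Prod (Profile n) (Profile n)) (L2Prod ℝ ℝ)) ℝ =>
      z.fst.snd := (WithLp.continuous_snd 2 _ _).comp (WithLp.continuous_fst 2 _ _)
  refine ((isClosed_Icc.preimage ((WithLp.continuous_fst 2 _ _).comp h1)).inter
    ((isClosed_modeSet qbar).preimage ((WithLp.continuous_snd 2 _ _).comp h1))).inter
    (isClosed_Ici.preimage (WithLp.continuous_snd 2 _ _))

theorem HybridArc.IsSolution.mem_nesFlowSet
    {z : HybridArc (L2Prod (L2Prod (L2Prod (Profile n) (Profile n)) (L2Prod ℝ ℝ)) ℝ)}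
    (hz : z.IsSolution ((nesData φ ηlo ηhi τd N₀).toHybridSystem T k)) {t : ℝ} {j : ℕ}
    (htj : (t, j) ∈ z.dom) :
    ((z.val t j).fst.snd.fst ∈ Icc 0 N₀ ∧ (z.val t j).fst.snd.snd ∈ modeSet qbar) ∧
      1 ≤ (z.val t j).snd := by
  refine hz.mem_flowSet isClosed_nesFlowSet ?_ ?_ htj
  · rintro x ⟨⟨h1, h2⟩, h3⟩
    exact ⟨⟨⟨zero_le_one.trans h1.1, h1.2⟩, h2⟩, h3⟩
  · rintro x ⟨⟨h1, h2⟩, h3⟩ w ⟨⟨m, -, -, h4, h5⟩, h6⟩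
    refine ⟨⟨?_, h5.1⟩, h6.symm ▸ h3⟩
    rw [h4]
    exact ⟨by linarith [h1.1], by linarith [h1.2]⟩

theorem isCompact_nesTarget : IsCompact (nesTarget qbar xt N₀) := by
  have h : nesTarget qbar xt N₀ =
      (WithLp.toLp 2) '' ({WithLp.toLp 2 (xt, xt)} ×ˢ
        ((WithLp.toLp 2) '' (Icc (0 : ℝ) N₀ ×ˢ modeSet qbar))) := by
    ext ψ
    constructor
    · rintro ⟨h1, h2, h3, h4⟩
      refine ⟨(ψ.fst, ψ.snd), ⟨?_, ⟨(ψ.snd.fst, ψ.snd.snd), ⟨h3, h4⟩, rfl⟩⟩, rfl⟩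
      change ψ.fst = WithLp.toLp 2 (xt, xt)
      calc ψ.fst = WithLp.toLp 2 (ψ.fst.fst, ψ.fst.snd) := rfl
        _ = _ := by rw [h1, h2]
    · rintro ⟨⟨a, b⟩, ⟨ha, ⟨⟨c, d⟩, ⟨hc, hd⟩, rfl⟩⟩, rfl⟩
      rw [mem_singleton_iff] at ha
      simp only at ha
      subst ha
      exact ⟨rfl, rfl, hc, hd⟩
  rw [h]
  have hmode : IsCompact (modeSet qbar) := (finite_range _).isCompact
  exact (isCompact_singleton.prod ((isCompact_Icc.prod hmode).image
    (WithLp.prod_continuous_toLp 2 _ _))).image (WithLp.prod_continuous_toLp 2 _ _)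

/-- On the flow set, the distance to the target is the distance of `(x₁, x₂)` to `(x̃, x̃)`. -/
theorem infDist_nesTarget
    {z : L2Prod (L2Prod (L2Prod (Profile n) (Profile n)) (L2Prod ℝ ℝ)) ℝ}
    (hτ : z.fst.snd.fst ∈ Icc 0 N₀) (hq : z.fst.snd.snd ∈ modeSet qbar) (hμ : 1 ≤ z.snd) :
    Metric.infDist z {y | y.fst ∈ nesTarget qbar xt N₀ ∧ 1 ≤ y.snd} =
      √(‖z.fst.fst.fst - xt‖ ^ 2 + ‖z.fst.fst.snd - xt‖ ^ 2) := by
  have hpt : WithLp.toLp 2 (WithLp.toLp 2 (WithLp.toLp 2 (xt, xt), z.fst.snd), z.snd) ∈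
      {y : L2Prod (L2Prod (L2Prod (Profile n) (Profile n)) (L2Prod ℝ ℝ)) ℝ |
        y.fst ∈ nesTarget qbar xt N₀ ∧ 1 ≤ y.snd} := ⟨⟨rfl, rfl, hτ, hq⟩, hμ⟩
  have hx : ∀ y : L2Prod (Profile n) (Profile n), y.fst = xt → y.snd = xt →
      dist z.fst.fst y = √(‖z.fst.fst.fst - xt‖ ^ 2 + ‖z.fst.fst.snd - xt‖ ^ 2) := by
    intro y h1 h2
    rw [WithLp.prod_dist_eq_of_L2, h1, h2, dist_eq_norm, dist_eq_norm]
  apply le_antisymm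
  · refine (Metric.infDist_le_dist_of_mem hpt).trans (le_of_eq ?_)
    rw [← hx (WithLp.toLp 2 (xt, xt)) rfl rfl, WithLp.prod_dist_eq_of_L2]
    rw [WithLp.prod_dist_eq_of_L2]
    simp
  · refine (Metric.le_infDist ⟨_, hpt⟩).2 ?_
    rintro y ⟨⟨h1, h2, -, -⟩, -⟩
    rw [← hx y.fst.fst h1 h2]
    exact (WithLp.dist_fst_le _ _).trans (WithLp.dist_fst_le _ _)

end Domain

/-! ### Quantities that do not increase along solutions. -/

section Invariants

variable {n qbar : ℕ} {φ : Fin qbar → Fin n → Profile n → ℝ} {xt : Profile n}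
  {T k N₀ τd ηlo ηhi : ℝ}
  {z : HybridArc (L2Prod (L2Prod (L2Prod (Profile n) (Profile n)) (L2Prod ℝ ℝ)) ℝ)}

/-- The dwell-time automaton bounds the number of jumps by the dilated time. -/
theorem timer_add_le (hT : 0 < T) (hk : 1 ≤ k)
    (hz : z.IsSolution ((nesData φ ηlo ηhi τd N₀).toHybridSystem T k)) {t : ℝ} {j : ℕ}
    (htj : (t, j) ∈ z.dom) :
    (z.val t j).fst.snd.fst + j - 1 / τd * omegaScale T k (z.val t j).snd (z.val 0 0).snd ≤
      (z.val 0 0).fst.snd.fst := by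
  refine z.isHTD.induction (P := fun t j => (z.val t j).fst.snd.fst + j -
    1 / τd * omegaScale T k (z.val t j).snd (z.val 0 0).snd ≤ (z.val 0 0).fst.snd.fst)
    (by simp [omegaScale_self]) ?_ ?_ htj
  · intro j a b hab hdom hP
    have hac := z.locallyAC_Icc hab.le hdom
    have hpos : ∀ s ∈ Icc a b, 0 < (z.val s j).snd := fun s hs =>
      zero_lt_one.trans_le (hz.mem_nesFlowSet (hdom s hs)).2
    refine le_trans (AbsolutelyContinuousOnInterval.le_of_ae_hasDerivAt_nonpos
      (f := fun s => (z.val s j).fst.snd.fst + j -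
        1 / τd * omegaScale T k (z.val s j).snd (z.val 0 0).snd) ?_ hab.le ?_) hP
    · have h1 : AbsolutelyContinuousOnInterval (fun s => (z.val s j).fst.snd.fst + (j : ℝ)) a b :=
        hac.withLp_fst.withLp_snd.withLp_fst.add
          contDiff_const.contDiffOn.absolutelyContinuousOnInterval
      refine h1.sub (AbsolutelyContinuousOnInterval.const_mul _ ?_)
      refine hac.withLp_snd.contDiffAt_comp
        (g := fun y => omegaScale T k y (z.val 0 0).snd) fun s hs => ?_
      rw [uIcc_of_le hab.le] at hs
      exact contDiffAt_omegaScale (hpos s hs)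
    · filter_upwards [hz.ae_flow hab hdom] with s hs hmem
      obtain ⟨-, v, ⟨⟨w, ⟨m, -, -, hw, -⟩, hv1⟩, hv2⟩, hd⟩ := hs hmem
      have hm := hpos s hmem
      have hd2 := hd.withLp_snd
      rw [hv2] at hd2
      refine ⟨_, ?_, (hd.withLp_fst.withLp_snd.withLp_fst.add_const (j : ℝ)).sub
        ((hasDerivAt_omegaScale_gain (a := (z.val 0 0).snd) hT hk hm hd2).const_mul (1 / τd))⟩
      rw [hv1]
      -- The timer grows at most at `μ / τ_d`, exactly the rate of `S / τ_d`.
      have := mul_le_mul_of_nonneg_left hw.2 hm.le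
      simp only [WithLp.smul_snd, WithLp.smul_fst, smul_eq_mul]
      linarith
  · intro t j h1 h2 hP
    obtain ⟨-, ⟨m, -, -, h3, -⟩, h4⟩ := hz.2.2 t j h1 h2
    rw [h3, h4]
    push_cast
    linarith

/-- The rate `-c μ` of `V` cancels the rate `c μ` of the exponent, and resets do not increase `V`.
The invariant refers to whichever mode is active at `(t, j)`; bounding every mode initially avoids
singling out the starting one. -/
theorem lyapunov_mul_exp_le {κ L σ ζ c δd B : ℝ} {l : Fin qbar → ℝ} (hT : 0 < T) (hk : 1 ≤ k)
    (hN₀ : 0 < N₀) (hηlo : 0 < ηlo) (hηhi : ηlo < ηhi) (hκ : 0 < κ) (hc : 0 < c)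
    (hlip : ∀ q, IsGloballyLipschitz (l q) (pseudoGradient (φ q)))
    (hreg : ∀ q, IsRegularMode κ L σ ζ xt (pseudoGradient (φ q)))
    (hdwell : 1 / τd * ((ηhi - ηlo) / N₀) ≤ δd * ζ)
    (hdecay : ∀ η ∈ Icc ηlo ηhi, ∀ a b : ℝ,
      -(1 / η) * a ^ 2 + 2 * η * σ * (a * b) - η * ((1 - δd) * ζ) * b ^ 2 ≤
        -c * (3 / 4 * a ^ 2 + (1 / (2 * κ ^ 2) + η ^ 2 / 2) * b ^ 2))
    (hreset : ∀ τ ∈ Icc 1 N₀, L ^ 2 / κ ^ 2 * eta ηlo ηhi N₀ (τ - 1) ^ 2 + 1 / (2 * κ ^ 2) ≤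
      eta ηlo ηhi N₀ τ ^ 2)
    (hz : z.IsSolution ((nesData φ ηlo ηhi τd N₀).toHybridSystem T k))
    (hB : ∀ m : Fin qbar, lyapunov (pseudoGradient (φ m)) xt
      (eta ηlo ηhi N₀ (z.val 0 0).fst.snd.fst) (z.val 0 0).fst.fst.fst (z.val 0 0).fst.fst.snd ≤ B)
    {t : ℝ} {j : ℕ} (htj : (t, j) ∈ z.dom) (m : Fin qbar)
    (hq : (z.val t j).fst.snd.snd = modeVal m) :
    lyapunov (pseudoGradient (φ m)) xt (eta ηlo ηhi N₀ (z.val t j).fst.snd.fst)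
        (z.val t j).fst.fst.fst (z.val t j).fst.fst.snd *
      Real.exp (c * omegaScale T k (z.val t j).snd (z.val 0 0).snd) ≤ B := by
  revert m
  refine z.isHTD.induction (P := fun t j => ∀ m : Fin qbar, (z.val t j).fst.snd.snd = modeVal m →
    lyapunov (pseudoGradient (φ m)) xt (eta ηlo ηhi N₀ (z.val t j).fst.snd.fst)
        (z.val t j).fst.fst.fst (z.val t j).fst.fst.snd *
      Real.exp (c * omegaScale T k (z.val t j).snd (z.val 0 0).snd) ≤ B)
    (fun m _ => by simpa [omegaScale_self] using hB m) ?_ ?_ htj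
  · intro j a b hab hdom hP m hqb
    have hac := z.locallyAC_Icc hab.le hdom
    have hflow := hz.ae_flow hab hdom
    have hC : ∀ s ∈ Icc a b, _ := fun s hs => hz.mem_nesFlowSet (hdom s hs)
    have hpos : ∀ s ∈ Icc a b, 0 < (z.val s j).snd := fun s hs =>
      zero_lt_one.trans_le (hC s hs).2
    -- The mode is frozen during a flow, so a single Lyapunov function serves the whole interval.
    have hqconst : ∀ s ∈ Icc a b, (z.val s j).fst.snd.snd = modeVal m := by
      have hder : ∀ᵐ s : ℝ, s ∈ uIcc a b →
          HasDerivAt (fun s => (z.val s j).fst.snd.snd) 0 s := by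
        rw [uIcc_of_le hab.le]
        filter_upwards [hflow] with s hs hmem
        obtain ⟨-, v, ⟨⟨w, ⟨m, -, -, -, hw⟩, hv1⟩, hv2⟩, hd⟩ := hs hmem
        have := hd.withLp_fst.withLp_snd.withLp_snd
        simpa [hv1, hw] using this
      obtain ⟨K, hK⟩ :=
        hac.withLp_fst.withLp_snd.withLp_snd.const_of_ae_hasDerivAt_zero hder
      rw [uIcc_of_le hab.le] at hK
      intro s hs
      rw [hK s hs, ← hK b (right_mem_Icc.2 hab.le), hqb]
    refine le_trans (AbsolutelyContinuousOnInterval.le_of_ae_hasDerivAt_nonpos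
      (f := fun s => lyapunov (pseudoGradient (φ m)) xt (eta ηlo ηhi N₀ (z.val s j).fst.snd.fst)
        (z.val s j).fst.fst.fst (z.val s j).fst.fst.snd *
        Real.exp (c * omegaScale T k (z.val s j).snd (z.val 0 0).snd)) ?_ hab.le ?_)
      (hP m (hqconst a (left_mem_Icc.2 hab.le)))
    · have hη : AbsolutelyContinuousOnInterval
          (fun s => eta ηlo ηhi N₀ (z.val s j).fst.snd.fst) a b :=
        hac.withLp_fst.withLp_snd.withLp_fst.contDiffAt_comp (g := eta ηlo ηhi N₀)
          fun _ _ => ((contDiff_id.mul contDiff_const).add contDiff_const).contDiffAt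
      have hV := AbsolutelyContinuousOnInterval.lyapunov (xt := xt) (hlip m)
        hac.withLp_fst.withLp_fst.withLp_fst hac.withLp_fst.withLp_fst.withLp_snd hη
      refine hV.mul (hac.withLp_snd.contDiffAt_comp
        (g := fun y => Real.exp (c * omegaScale T k y (z.val 0 0).snd)) fun s hs => ?_)
      rw [uIcc_of_le hab.le] at hs
      exact (contDiffAt_const.mul (contDiffAt_omegaScale (hpos s hs))).exp
    · filter_upwards [hflow] with s hs hmem
      obtain ⟨-, v, ⟨⟨w, ⟨m', hm', hw1, hw2, hw3⟩, hv1⟩, hv2⟩, hd⟩ := hs hmem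
      have hmm : m' = m := modeVal_injective (hm'.symm.trans (hqconst s hmem))
      subst hmm
      have hm := hpos s hmem
      have hd2 := hd.withLp_snd
      rw [hv2] at hd2
      have hη : eta ηlo ηhi N₀ (z.val s j).fst.snd.fst ∈ Icc ηlo ηhi :=
        eta_mem_Icc hηhi hN₀ (hC s hmem).1.1
      have hd1 := hd.withLp_fst
      rw [hv1] at hd1
      have hdη : HasDerivAt (fun s => eta ηlo ηhi N₀ (z.val s j).fst.snd.fst)
          ((z.val s j).snd * (w.snd.fst * ((ηhi - ηlo) / N₀))) s := by
        have := (hd1.withLp_snd.withLp_fst.mul_const ((ηhi - ηlo) / N₀)).add_const ηlo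
        simpa [mul_assoc, eta] using this
      have hx1 := hd1.withLp_fst.withLp_fst
      have hx2 := hd1.withLp_fst.withLp_snd
      simp only [WithLp.smul_fst, WithLp.smul_snd, hw1, nesField] at hx1 hx2
      have hV := HasDerivAt.lyapunov (xt := xt) (hreg m').differentiable hx1 hx2 hdη
      have hω := hasDerivAt_omegaScale_gain (a := (z.val 0 0).snd) hT hk hm hd2
      refine ⟨_, ?_, hV.mul (hω.const_mul c).exp⟩
      -- This is `η̇ / μ`; the dwell-time bound keeps it within the fraction `δd` of cocoercivity.
      have hslope : w.snd.fst * ((ηhi - ηlo) / N₀) ≤ δd * ζ := by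
        refine le_trans ?_ hdwell
        have : 0 ≤ (ηhi - ηlo) / N₀ := div_nonneg (by linarith) hN₀.le
        gcongr
        exact hw2.2
      have hle := (hreg m').lyapunov_deriv_le hκ hc (hηlo.trans_le hη.1) hm.le hslope
        (hdecay _ hη) (z.val s j).fst.fst.fst (z.val s j).fst.fst.snd
      have he := Real.exp_pos (c * omegaScale T k (z.val s j).snd (z.val 0 0).snd)
      have hle' := mul_le_mul_of_nonneg_right hle he.le
      refine (add_le_add_left hle' _).trans (le_of_eq ?_)
      ring
  · intro t j h1 h2 hP m' hm'
    obtain ⟨⟨⟨hD, -⟩, -⟩, ⟨m, hq, hx, hτ, -⟩, hμ⟩ := hz.2.2 t j h1 h2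
    refine le_trans ?_ (hP m hq)
    rw [hμ, hx, hτ]
    gcongr
    exact (hreg m).lyapunov_reset_le (hreg m') hκ (hreset _ hD) _ _

end Invariants

/-- Since `η` is increasing, the worst case takes `τ = N₀` on the left and `τ = 1` on the right;
that case is `γ̄ ≤ 1` multiplied by `η(1)²`. -/
theorem TuningGuidelines.reset_le {qbar : ℕ} {κ l σ : Fin qbar → ℝ} {ηlo ηhi τd N₀ δη δd : ℝ}
    (h : TuningGuidelines κ l σ ηlo ηhi τd N₀ δη δd) (hκ : 0 < ⨅ q, κ q) (hN₀ : 1 ≤ N₀)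
    (hηlo : 0 < ηlo) (hηhi : ηlo < ηhi) {τ : ℝ} (hτ : τ ∈ Icc 1 N₀) :
    (⨆ q, l q) ^ 2 / (⨅ q, κ q) ^ 2 * eta ηlo ηhi N₀ (τ - 1) ^ 2 + 1 / (2 * (⨅ q, κ q) ^ 2) ≤
      eta ηlo ηhi N₀ τ ^ 2 := by
  have hN : 0 < N₀ := by linarith
  have h1 : 0 < eta ηlo ηhi N₀ 1 :=
    hηlo.trans_le (eta_mem_Icc hηhi hN ⟨zero_le_one, hN₀⟩).1
  have h2 : 0 < eta ηlo ηhi N₀ (τ - 1) :=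
    hηlo.trans_le (eta_mem_Icc hηhi hN ⟨by linarith [hτ.1], by linarith [hτ.2]⟩).1
  have hγ := h.gammaBar_mem.2
  unfold gammaBar at hγ
  have hγ' := mul_le_mul_of_nonneg_right hγ (sq_nonneg (eta ηlo ηhi N₀ 1))
  calc _ ≤ (⨆ q, l q) ^ 2 / (⨅ q, κ q) ^ 2 * eta ηlo ηhi N₀ (N₀ - 1) ^ 2 +
        1 / (2 * (⨅ q, κ q) ^ 2) := by
        gcongr
        exact eta_mono hηhi hN (by linarith [hτ.2])
    _ = _ := by field_simp
    _ ≤ _ := hγ'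
    _ ≤ eta ηlo ηhi N₀ τ ^ 2 := by
        rw [one_mul]
        gcongr
        exact eta_mono hηhi hN hτ.1

end PTNash

/-! ### Assembly of the stability estimate. -/

open PTNash

theorem proposition5 (n qbar : ℕ) (hn : 2 ≤ n) (hqbar : 1 ≤ qbar)
    (φ : Fin qbar → Fin n → PTNash.Profile n → ℝ)
    (hφ : ∀ q i, ContDiff ℝ 1 (φ q i))
    (xt : PTNash.Profile n)
    (hxt : ∀ q, PTNash.IsNashEquilibrium (φ q) xt)
    (κ l σ : Fin qbar → ℝ)
    (hκ : ∀ q, 0 < κ q) (hl : ∀ q, 0 < l q) (hσ : ∀ q, 0 < σ q)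
    (hmono : ∀ q, PTNash.IsStronglyMonotone (κ q) (PTNash.pseudoGradient (φ q)))
    (hlip : ∀ q, PTNash.IsGloballyLipschitz (l q) (PTNash.pseudoGradient (φ q)))
    (hjac : ∀ q, PTNash.JacobianRegular (σ q) (PTNash.pseudoGradient (φ q)))
    (T k N₀ τd ηlo ηhi δη δd : ℝ)
    (hT : 0 < T) (hk : 1 ≤ k) (hN₀ : 1 ≤ N₀) (hτd : 0 < τd)
    (hηlo : 0 < ηlo) (hηhi : ηlo < ηhi)
    (htune : PTNash.TuningGuidelines κ l σ ηlo ηhi τd N₀ δη δd)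
    (hdwell : PTNash.dwellThreshold κ l σ ηlo ηhi δη δd < τd) :
    PTNash.PTStableViaFlows (PTNash.nesData φ ηlo ηhi τd N₀) T k
      (PTNash.nesTarget qbar xt N₀) := by
  have : Nonempty (Fin qbar) := ⟨⟨0, hqbar⟩⟩
  have hN : 0 < N₀ := by linarith
  have hκ0 : 0 < ⨅ q, κ q := by
    obtain ⟨q, hq⟩ := exists_eq_ciInf_of_finite (f := κ)
    exact hq ▸ hκ q
  have hσ0 : 0 < ⨆ q, σ q := by
    obtain ⟨q, hq⟩ := exists_eq_ciSup_of_finite (f := σ)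
    exact hq ▸ hσ q
  have hζ0 : 0 < zetaMin κ l := by
    obtain ⟨q, hq⟩ := exists_eq_ciInf_of_finite (f := fun q => κ q / l q ^ 2)
    rw [zetaMin, ← hq]
    have := hκ q
    have := hl q
    positivity
  have hreg : ∀ q, IsRegularMode (⨅ q, κ q) (⨆ q, l q) (⨆ q, σ q) (zetaMin κ l) xt
      (pseudoGradient (φ q)) := fun q =>
    isRegularMode_of_isStronglyMonotone (hκ q) (hl q) (hmono q) (hlip q) (hjac q)
      ((hxt q).pseudoGradient_eq_zero fun i => (hφ q i).differentiable one_ne_zero)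
      (ciInf_le (finite_range κ).bddBelow q) (le_ciSup (finite_range l).bddAbove q)
      (le_ciSup (finite_range σ).bddAbove q)
      (ciInf_le (finite_range fun q => κ q / l q ^ 2).bddBelow q)
  obtain ⟨c, hc, hdecay⟩ := exists_decay_rate hηlo hηhi htune.deltaEta_mem.1 htune.sum_mem.2
    hσ0 hζ0 hκ0 htune.eta_le
  have hslope : 1 / τd * ((ηhi - ηlo) / N₀) ≤ δd * zetaMin κ l := by
    have h0 : 0 < (ηhi - ηlo) / N₀ := div_pos (by linarith) hN
    have h1 : ηhi - ηlo ≠ 0 := by linarith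
    calc _ ≤ δd * (N₀ / (ηhi - ηlo)) * zetaMin κ l * ((ηhi - ηlo) / N₀) := by
          gcongr
          exact htune.dwell_le
      _ = _ := by field_simp
  set cl := min (1 / 4) (ηlo ^ 2 * (⨅ q, κ q) ^ 2 / 2) with hcl
  set cu := 3 / 4 + ηhi ^ 2 * (⨆ q, l q) ^ 2 / 2 with hcu
  have hcl0 : 0 < cl := lt_min (by norm_num) (by positivity)
  have hcu0 : 0 < cu := by positivity
  -- The square root leaves the rate `c / 2`, split evenly between `S` and `j`. The factor `exp(c τd
  -- N₀ / 4)` accounts for the `N₀` jumps that the timer permits in advance.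
  refine ⟨isCompact_nesTarget, _, isKLL_exp (C := √(cu / cl) * Real.exp (c * τd * N₀ / 4))
    (a := c / 4) (b := c * τd / 4) (by positivity) (by positivity) (by positivity), ?_⟩
  intro z hz t j htj
  have hC := hz.mem_nesFlowSet htj
  have hC0 := hz.mem_nesFlowSet z.zero_mem
  rw [infDist_nesTarget hC.1.1 hC.1.2 hC.2, infDist_nesTarget hC0.1.1 hC0.1.2 hC0.2,
    dilatedTime_eq hT hk hz (fun t j h => (hz.mem_nesFlowSet h).2) htj]
  set S := omegaScale T k (z.val t j).snd (z.val 0 0).snd with hS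
  set R := ‖(z.val t j).fst.fst.fst - xt‖ ^ 2 + ‖(z.val t j).fst.fst.snd - xt‖ ^ 2 with hR
  set R₀ := ‖(z.val 0 0).fst.fst.fst - xt‖ ^ 2 + ‖(z.val 0 0).fst.fst.snd - xt‖ ^ 2 with hR0
  obtain ⟨m, hm⟩ := hC.1.2
  have hη := eta_mem_Icc hηhi hN hC.1.1
  have hη0 := eta_mem_Icc hηhi hN hC0.1.1
  have hV := lyapunov_mul_exp_le hT hk hN hηlo hηhi hκ0 hc hlip hreg hslope hdecay
    (fun τ hτ => htune.reset_le hκ0 hN₀ hηlo hηhi hτ) hz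
    (fun m => (hreg m).lyapunov_le_mul_norm_sq (hηlo.le.trans hη0.1) hη0.2 _ _) htj m hm.symm
  have hlow := (hreg m).mul_norm_sq_le_lyapunov hκ0 hηlo hη.1 (z.val t j).fst.fst.fst
    (z.val t j).fst.fst.snd
  -- The timer is nonnegative at `(t, j)` and at most `N₀` initially.
  have hjump : τd * (j - N₀) ≤ S := by
    have h := timer_add_le hT hk hz htj
    have h1 : (j : ℝ) - N₀ ≤ S / τd := by
      rw [div_eq_inv_mul, ← one_div]
      linarith [hC.1.1.1, hC0.1.1.2]
    rw [le_div_iff₀ hτd] at h1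
    linarith
  have hRle : R ≤ cu / cl * R₀ * Real.exp (-(c * S)) := by
    have h1 : cl * R * Real.exp (c * S) ≤ cu * R₀ :=
      (mul_le_mul_of_nonneg_right hlow (Real.exp_pos _).le).trans hV
    rw [Real.exp_neg, ← div_eq_mul_inv, le_div_iff₀ (Real.exp_pos _), div_mul_eq_mul_div,
      le_div_iff₀ hcl0]
    linarith
  have hsqrt : √(Real.exp (-(c * S))) = Real.exp (-(c * S) / 2) := (Real.exp_half _).symm
  calc √R ≤ √(cu / cl * R₀ * Real.exp (-(c * S))) := Real.sqrt_le_sqrt hRle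
    _ = √(cu / cl) * √R₀ * Real.exp (-(c * S) / 2) := by
        rw [Real.sqrt_mul (by positivity), Real.sqrt_mul (by positivity), hsqrt]
    _ ≤ √(cu / cl) * √R₀ * Real.exp (c * τd * N₀ / 4 + (-(c / 4 * S) - c * τd / 4 * j)) := by
        gcongr
        -- One half of `c S / 2` stays; the other is bounded below through `hjump` multiplied by `c
        -- / 4`.
        nlinarith
    _ = _ := by
        rw [Real.exp_add]
        ring
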